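/- Let $X$ be a Banach space over $\mathbb K=\mathbb R$ or $\mathbb C$. Notation: $(e_n)$ is the unit vector basis of $\ell_2$; $(g_n)$ is a sequence of independent standard (real) Gaussian variables on a probability space $(\Omega,\mu)$; for a bounded operator $T:Y\to Z$ between normed spaces, $T^*:Z^*\to Y^*$ is its adjoint and $\pi_1(T)$ is its $1$-summing norm, i.e. the infimum of all $C\ge 0$ such that $\sum_{i}\|Ty_i\|\le C\sup\{\sum_i|f(y_i)| : f\in Y^*,\ \|f\|\le 1\}$ for all finite families $(y_i)$ in $Y$. $\ell_2\otimes Y$ denotes the finite rank bounded operators from $\ell_2$ to $Y$, and for $T\in\ell_2\otimes Y$ we put $\ell(T)=\big(\int_\Omega\|\sum_{n=1}^\infty g_n\,Te_n\|^2\,d\mu\big)^{1/2}$, the series being summed in $L_2(\mu,Y)$. $\Gamma_1(Y,\ell_2)$ denotes the bounded operators $S:Y\to\ell_2$ that admit a factorization $S=BA$ with bounded operators $A:Y\to L_1(\nu)$ and $B:L_1(\nu)\to\ell_2$ for some measure $\nu$, and $\gamma_1(S)$ is the infimum of $\|A\|\,\|B\|$ over all such factorizations. $X$ has the Gaussian average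 property (GAP) if there is a constant $C$ such that $\ell(T)\le C\,\pi_1(T^*)$ for all $T\in\ell_2\otimes X$. **Theorem 2.1.** If $X$ has GAP, then there is a constant $K$ such that for every linear subspace $E\subseteq X$ the following hold: 1. for every $T\in\ell_2\otimes E$, $$\pi_1(T^*)\le K\,\pi_1(T^*Q),$$ where $Q:X^*\to E^*$ is the canonical quotient map (restriction of functionals to $E$); 2. consequently, every $S\in\Gamma_1(E,\ell_2)$ admits an extension $\widetilde S\in\Gamma_1(X,\ell_2)$ with $$\gamma_1(\widetilde S)\le K\,\gamma_1(S).$$ -/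

import Mathlib

open MeasureTheory ProbabilityTheory Filter Topology
open scoped NNReal ENNReal

universe u

noncomputable section

namespace GaussianAverage

/-- The Hilbert space `ℓ₂` over `𝕜`. -/
abbrev Ell2 (𝕜 : Type*) [RCLike 𝕜] : Type _ := lp (fun _ : ℕ => 𝕜) 2

/-- The unit vector basis of `ℓ₂`. -/
def unitVec (𝕜 : Type*) [RCLike 𝕜] (n : ℕ) : Ell2 𝕜 := lp.single 2 n (1 : 𝕜)

/-- The Banach space adjoint `T* : Y* → X*` of `T : X → Y`, that is `T* f = f ∘ T`. -/
def adj {𝕜 X Y : Type*} [RCLike 𝕜] [NormedAddCommGroup X] [NormedSpace 𝕜 X]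
    [NormedAddCommGroup Y] [NormedSpace 𝕜 Y] (T : X →L[𝕜] Y) :
    StrongDual 𝕜 Y →L[𝕜] StrongDual 𝕜 X :=
  (ContinuousLinearMap.compL 𝕜 X Y 𝕜).flip T

/-- The canonical quotient map `Q : X* → E*` (restriction of functionals to `E`). -/
def quotMap {𝕜 X : Type*} [RCLike 𝕜] [NormedAddCommGroup X] [NormedSpace 𝕜 X]
    (E : Submodule 𝕜 X) : StrongDual 𝕜 X →L[𝕜] StrongDual 𝕜 E :=
  adj E.subtypeL

/-- Finite rank operators. For operators from `ℓ₂` to `X` these are exactly the elements of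
the tensor product `ℓ₂ ⊗ X`. -/
def IsFiniteRank {𝕜 X Y : Type*} [RCLike 𝕜] [NormedAddCommGroup X] [NormedSpace 𝕜 X]
    [NormedAddCommGroup Y] [NormedSpace 𝕜 Y] (T : X →L[𝕜] Y) : Prop :=
  FiniteDimensional 𝕜 (LinearMap.range (T : X →ₗ[𝕜] Y))

/-! ### The 1-summing norm -/

/-- The weak `ℓ₁`-norm `sup {∑ᵢ |f(xᵢ)| : f ∈ X*, ‖f‖ ≤ 1}` of a finite family in `X`. -/
def weakL1Norm (𝕜 : Type*) {X : Type*} [RCLike 𝕜] [NormedAddCommGroup X] [NormedSpace 𝕜 X]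
    {n : ℕ} (x : Fin n → X) : ℝ≥0∞ :=
  ⨆ (f : StrongDual 𝕜 X) (_ : ‖f‖ ≤ 1), ∑ i, ‖f (x i)‖ₑ

/-- The 1-summing norm `π₁(T)`: the infimum of all constants `C` with
`∑ᵢ ‖T xᵢ‖ ≤ C sup {∑ᵢ |f(xᵢ)| : ‖f‖ ≤ 1}` for all finite families
(so `∞` exactly when `T` is not 1-summing). -/
def piOne {𝕜 X Y : Type*} [RCLike 𝕜] [NormedAddCommGroup X] [NormedSpace 𝕜 X]
    [NormedAddCommGroup Y] [NormedSpace 𝕜 Y] (T : X →L[𝕜] Y) : ℝ≥0∞ :=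
  ⨅ (C : ℝ≥0) (_ : ∀ (n : ℕ) (x : Fin n → X), ∑ i, ‖T (x i)‖ₑ ≤ C * weakL1Norm 𝕜 x), (C : ℝ≥0∞)

/-! ### The `ℓ`-norm and the Gaussian average property -/

/-- The law of a sequence of independent standard Gaussian variables: on the probability space
`(ℕ → ℝ, gaussianSeq)` the coordinates `ω ↦ ω n` are such a sequence `(gₙ)`. -/
def gaussianSeq : Measure (ℕ → ℝ) := Measure.infinitePi (fun _ : ℕ => gaussianReal 0 1)

/-- The partial sums `∑_{j < n} g_j T e_j`. -/
def gaussianPartialSum {𝕜 X : Type*} [RCLike 𝕜] [NormedAddCommGroup X] [NormedSpace 𝕜 X]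
    (T : Ell2 𝕜 →L[𝕜] X) (n : ℕ) (ω : ℕ → ℝ) : X :=
  ∑ j ∈ Finset.range n, ((ω j : ℝ) : 𝕜) • T (unitVec 𝕜 j)

/-- `f` is the sum of the series `∑ₙ gₙ T eₙ` in `L₂(gaussianSeq, X)`. -/
def IsGaussianSum {𝕜 X : Type*} [RCLike 𝕜] [NormedAddCommGroup X] [NormedSpace 𝕜 X]
    (T : Ell2 𝕜 →L[𝕜] X) (f : (ℕ → ℝ) → X) : Prop :=
  MemLp f 2 gaussianSeq ∧
    Tendsto (fun n => eLpNorm (fun ω => gaussianPartialSum T n ω - f ω) 2 gaussianSeq)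
      atTop (𝓝 0)

/-- The `ℓ`-norm `ℓ(T) = (∫ ‖∑ₙ gₙ T eₙ‖²)^{1/2}`, the series being summed in `L₂`. The sum is
unique almost everywhere if it exists, so that the infimum below is over a single value; it is `∞`
if the series does not converge, i.e. if `T` is not an `ℓ`-operator. -/
def ellNorm {𝕜 X : Type*} [RCLike 𝕜] [NormedAddCommGroup X] [NormedSpace 𝕜 X]
    (T : Ell2 𝕜 →L[𝕜] X) : ℝ≥0∞ :=
  ⨅ (f : (ℕ → ℝ) → X) (_ : IsGaussianSum T f), eLpNorm f 2 gaussianSeq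

/-- The Gaussian average property: there is a constant `K` with `ℓ(T) ≤ K π₁(T*)` for all
`T ∈ ℓ₂ ⊗ X`. -/
def HasGAP (𝕜 X : Type*) [RCLike 𝕜] [NormedAddCommGroup X] [NormedSpace 𝕜 X] : Prop :=
  ∃ K : ℝ≥0, ∀ T : Ell2 𝕜 →L[𝕜] X, IsFiniteRank T → ellNorm T ≤ K * piOne (adj T)

/-! ### Operators factoring through `L₁` -/

/-- `S ∈ Γ₁(X, Y)`: the operator `S` factors as `S = B A` with bounded `A : X → L₁(ν)` and
`B : L₁(ν) → Y` for some measure `ν`. -/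
def FactorsThroughL1 {𝕜 : Type*} {X : Type u} {Y : Type*} [RCLike 𝕜]
    [NormedAddCommGroup X] [NormedSpace 𝕜 X] [NormedAddCommGroup Y] [NormedSpace 𝕜 Y]
    (S : X →L[𝕜] Y) : Prop :=
  ∃ (Ω : Type u) (_ : MeasurableSpace Ω) (ν : Measure Ω)
    (A : X →L[𝕜] Lp 𝕜 1 ν) (B : Lp 𝕜 1 ν →L[𝕜] Y), S = B ∘L A

/-- `γ₁(S) = inf ‖A‖ ‖B‖` over all factorizations `S = B A` through a space `L₁(ν)`
(`∞` if there is none). -/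
def gammaOne {𝕜 : Type*} {X : Type u} {Y : Type*} [RCLike 𝕜]
    [NormedAddCommGroup X] [NormedSpace 𝕜 X] [NormedAddCommGroup Y] [NormedSpace 𝕜 Y]
    (S : X →L[𝕜] Y) : ℝ≥0∞ :=
  sInf {c | ∃ (Ω : Type u) (_ : MeasurableSpace Ω) (ν : Measure Ω)
    (A : X →L[𝕜] Lp 𝕜 1 ν) (B : Lp 𝕜 1 ν →L[𝕜] Y), S = B ∘L A ∧ c = ‖A‖ₑ * ‖B‖ₑ}

end GaussianAverage

end

noncomputable section

namespace GaussianAverage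

/-! The inequality `π₁(T*) ≤ k ℓ(T)` holds in every space: `‖T*φ‖` is the `ℓ₂` norm of the
coefficients of the scalar Gaussian sum `φ(∑ gⱼ T eⱼ)`, hence at most `k` times its first moment,
and summing over functionals brings in their weak `ℓ₁` norm (`piOne_adj_le`). The `ℓ`-norm of `T`
does not change when `E` is enlarged to `X`, so GAP of `X` bounds it by `C π₁((ιT)*) = C π₁(T*Q)`,
where `ι : E → X` is the inclusion. This gives the first claim.

The extension comes from trace duality. For `S = BA` through `L₁(ν)` and `xⱼ ∈ E`, the trace `∑ (S
xⱼ)ⱼ` is at most `k ‖A‖ ‖B‖` times the mean of `‖∑ gⱼ xⱼ‖`, because `B` acts on `L₁(ν, ℓ₂)` and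
Gaussian averages recover the `ℓ₂` norm pointwise (`enorm_trace_comp_le`). GAP bounds this mean by
`C π₁`, which is in turn at most the projective norm of `∑ xⱼ ⊗ coordⱼ` in `X ⊗ C(B₂)`, where `B₂`
is the weakly compact unit ball of `ℓ₂` (`piOne_adj_finiteOp_le`). So the trace functional extends
by Hahn-Banach to `X ⊗ C(B₂)`, that is, to an operator `A : X → C(B₂)*` such that the barycentre of
the measure `A x` is `S x` for `x ∈ E` (`exists_dual_operator`).

It remains to factor the barycentre map `C(B₂)* → ℓ₂` through a concrete `L₁` space. Successive
approximation from a dense sequence writes each point of the ball as `y = ∑ wᵢ 1_{Fᵢ}(y) zᵢ` over a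
countable index set, with `‖zᵢ‖ ≤ 3` and `∑ wᵢ 1_{Fᵢ} ≤ 2`. Then `Λ ↦ (wᵢ Λ(Fᵢ))ᵢ` followed by `(cᵢ)
↦ ∑ cᵢ zᵢ` factors the barycentre map through `ℓ₁` (`BallAtoms.sumOp_coeffOp`). -/

/-! ### Scalar Gaussian sums and their first moments -/

instance : IsProbabilityMeasure gaussianSeq := by
  unfold gaussianSeq; infer_instance

lemma gaussianSeq_map_sum {ι : Type*} (g : ι → ℕ) (hg : Function.Injective g) (a : ι → ℝ)
    (s : Finset ι) :
    gaussianSeq.map (fun ω => ∑ j ∈ s, a j * ω (g j)) =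
      gaussianReal 0 (∑ j ∈ s, (a j ^ 2).toNNReal) := by
  classical
  have hind : iIndepFun (fun (j : ι) (ω : ℕ → ℝ) => a j * ω (g j)) gaussianSeq := by
    have h := (iIndepFun_infinitePi (P := fun _ : ℕ => gaussianReal 0 1)
      (X := fun _ x => x) (fun _ => measurable_id)).precomp hg
    exact h.comp (fun j x => a j * x) (fun j => by fun_prop)
  induction s using Finset.induction_on with
  | empty => simp [Measure.map_const]
  | insert j s hj ih =>
    have h1 : gaussianSeq.map (fun ω => a j * ω (g j)) = gaussianReal 0 ((a j ^ 2).toNNReal) := by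
      have h2 : gaussianSeq.map (fun ω => ω (g j)) = gaussianReal 0 1 :=
        Measure.infinitePi_map_eval (fun _ : ℕ => gaussianReal 0 1) (g j)
      have h3 : gaussianSeq.map (fun ω => a j * ω (g j))
          = (gaussianSeq.map (fun ω => ω (g j))).map (fun x => a j * x) := by
        rw [Measure.map_map (by fun_prop) (by fun_prop)]; rfl
      rw [h3, h2, gaussianReal_map_const_mul]
      congr 1
      · simp
      · ext; simp [sq_nonneg]
    have h4 := hind.indepFun_finsetSum_of_notMem (fun i => by fun_prop) hj
    have h5 := gaussianReal_add_gaussianReal_of_indepFun h4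
      (by rw [← ih]; congr 1; ext ω; simp) h1
    rw [Finset.sum_insert hj, add_comm, ← zero_add (0 : ℝ), ← h5]
    congr 1
    ext ω
    simp [Finset.sum_insert hj, add_comm]

/-- The first absolute moment of a standard Gaussian variable. -/
def gaussianMoment : ℝ≥0∞ := ∫⁻ x, ‖x‖ₑ ∂(gaussianReal 0 1)

lemma gaussianMoment_ne_zero : gaussianMoment ≠ 0 := by
  intro h
  rw [gaussianMoment, lintegral_eq_zero_iff (by fun_prop)] at h
  have h1 : ∀ᵐ x ∂(gaussianReal 0 1), x = 0 := by
    filter_upwards [h] with x hx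
    simpa using hx
  have : NullSingletonClass (gaussianReal 0 1) := nullSingletonClass_gaussianReal one_ne_zero
  have h2 : (gaussianReal 0 1) {(0 : ℝ)} = 0 := measure_singleton 0
  have h3 : (gaussianReal 0 1) Set.univ ≤ 0 := by
    rw [← Set.union_compl_self {(0 : ℝ)}]
    refine (measure_union_le _ _).trans ?_
    rw [h2, zero_add]
    exact le_of_eq h1
  simp at h3

/-- Rotation invariance: the sum is Gaussian of variance `‖a‖²`, so it has the law of `‖a‖ g` with
`g` standard. -/
lemma lintegral_enorm_gaussian_sum {N : ℕ} (a : EuclideanSpace ℝ (Fin N)) :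
    ∫⁻ ω, ‖∑ j : Fin N, a j * ω j‖ₑ ∂gaussianSeq = gaussianMoment * ‖a‖ₑ := by
  have h1 : ∫⁻ ω, ‖∑ j : Fin N, a j * ω j‖ₑ ∂gaussianSeq
      = ∫⁻ x, ‖x‖ₑ ∂(gaussianSeq.map (fun ω => ∑ j : Fin N, a j * ω j)) := by
    rw [lintegral_map (by fun_prop) (by fun_prop)]
  have h2 : gaussianReal 0 (∑ j : Fin N, (a j ^ 2).toNNReal)
      = (gaussianReal 0 1).map (fun x => ‖a‖ * x) := by
    rw [gaussianReal_map_const_mul]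
    congr 1
    · simp
    · ext
      simp [EuclideanSpace.norm_sq_eq, max_eq_left (sq_nonneg _)]
  rw [h1, gaussianSeq_map_sum (fun j : Fin N => (j : ℕ)) Fin.val_injective (fun j => a j), h2,
    lintegral_map (by fun_prop) (by fun_prop)]
  simp_rw [enorm_mul, enorm_norm]
  rw [lintegral_const_mul _ (by fun_prop), mul_comm]; rfl

lemma gaussianMoment_ne_top : gaussianMoment ≠ ∞ := by
  have := (memLp_id_gaussianReal (μ := 0) (v := 1) 1).eLpNorm_ne_top
  simpa [eLpNorm_one_eq_lintegral_enorm, gaussianMoment] using this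

/-- A constant in the lower Khintchine-Kahane inequality for Gaussian sums. -/
def khintchineConst : ℝ≥0 := 2 * (gaussianMoment⁻¹).toNNReal

/-- The variables are real while the coefficients may be complex, so the real identity is applied to
the real and imaginary parts separately. Each of the two sums is dominated pointwise by the full
sum, which explains the factor 2 in `khintchineConst`. -/
lemma enorm_le_lintegral_gaussian_sum {𝕜 : Type*} [RCLike 𝕜] {N : ℕ}
    (a : EuclideanSpace 𝕜 (Fin N)) :
    ‖a‖ₑ ≤ khintchineConst * ∫⁻ ω, ‖∑ j : Fin N, ((ω j : ℝ) : 𝕜) * a j‖ₑ ∂gaussianSeq := by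
  set I := ∫⁻ ω, ‖∑ j : Fin N, ((ω j : ℝ) : 𝕜) * a j‖ₑ ∂gaussianSeq with hI
  let b : EuclideanSpace ℝ (Fin N) := WithLp.toLp 2 fun j => RCLike.re (a j)
  let c : EuclideanSpace ℝ (Fin N) := WithLp.toLp 2 fun j => RCLike.im (a j)
  have hm : gaussianMoment⁻¹ * gaussianMoment = 1 :=
    ENNReal.inv_mul_cancel gaussianMoment_ne_zero gaussianMoment_ne_top
  have hb : ‖b‖ₑ ≤ gaussianMoment⁻¹ * I := by
    calc ‖b‖ₑ = gaussianMoment⁻¹ * (gaussianMoment * ‖b‖ₑ) := by rw [← mul_assoc, hm, one_mul]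
      _ ≤ _ := by
        rw [← lintegral_enorm_gaussian_sum]
        refine mul_le_mul_right (lintegral_mono fun ω => enorm_le_iff_norm_le.2 ?_) _
        refine le_trans (le_of_eq ?_) (RCLike.norm_re_le_norm _)
        rw [Real.norm_eq_abs]; simp [b, mul_comm]
  have hc : ‖c‖ₑ ≤ gaussianMoment⁻¹ * I := by
    calc ‖c‖ₑ = gaussianMoment⁻¹ * (gaussianMoment * ‖c‖ₑ) := by rw [← mul_assoc, hm, one_mul]
      _ ≤ _ := by
        rw [← lintegral_enorm_gaussian_sum]
        refine mul_le_mul_right (lintegral_mono fun ω => enorm_le_iff_norm_le.2 ?_) _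
        refine le_trans (le_of_eq ?_) (RCLike.norm_im_le_norm _)
        rw [Real.norm_eq_abs]; simp [c, mul_comm]
  have habc : ‖a‖ₑ ≤ ‖b‖ₑ + ‖c‖ₑ := by
    have h1 : ‖a‖ ≤ ‖b‖ + ‖c‖ := by
      have h2 : ‖a‖ ^ 2 = ‖b‖ ^ 2 + ‖c‖ ^ 2 := by
        simp only [EuclideanSpace.norm_sq_eq, ← Finset.sum_add_distrib]
        refine Finset.sum_congr rfl fun j _ => ?_
        rw [← RCLike.normSq_eq_def', RCLike.normSq_apply]; simp [b, c, sq]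
      have := norm_nonneg b
      have := norm_nonneg c
      nlinarith [norm_nonneg a]
    calc ‖a‖ₑ = ENNReal.ofReal ‖a‖ := (ofReal_norm a).symm
      _ ≤ ENNReal.ofReal (‖b‖ + ‖c‖) := ENNReal.ofReal_le_ofReal h1
      _ = _ := by rw [ENNReal.ofReal_add (norm_nonneg _) (norm_nonneg _), ofReal_norm, ofReal_norm]
  have hk : (khintchineConst : ℝ≥0∞) = 2 * gaussianMoment⁻¹ := by
    rw [khintchineConst, ENNReal.coe_mul, ENNReal.coe_toNNReal
      (ENNReal.inv_ne_top.2 gaussianMoment_ne_zero)]; rfl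
  rw [hk, two_mul, add_mul]
  exact habc.trans (add_le_add hb hc)

lemma khintchineConst_ne_zero : khintchineConst ≠ 0 := by
  simp [khintchineConst, ENNReal.toNNReal_eq_zero_iff, gaussianMoment_ne_top,
    gaussianMoment_ne_zero]

/-! ### The weak `ℓ₁` norm -/

section Weak

variable {𝕜 X : Type*} [RCLike 𝕜] [NormedAddCommGroup X] [NormedSpace 𝕜 X]

lemma sum_enorm_apply_le_weakL1Norm (F : StrongDual 𝕜 X) {n : ℕ} (x : Fin n → X) :
    ∑ i, ‖F (x i)‖ₑ ≤ ‖F‖ₑ * weakL1Norm 𝕜 x := by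
  rcases eq_or_ne F 0 with rfl | hF
  · simp
  have hF' : ‖F‖ ≠ 0 := norm_ne_zero_iff.2 hF
  have h1 : ‖((‖F‖⁻¹ : ℝ) : 𝕜) • F‖ ≤ 1 := by
    rw [norm_smul]; simp [hF']
  have h2 : F = ((‖F‖ : ℝ) : 𝕜) • (((‖F‖⁻¹ : ℝ) : 𝕜) • F) := by
    rw [smul_smul, ← RCLike.ofReal_mul, mul_inv_cancel₀ hF']; simp
  have h3 : ∀ i, ‖F (x i)‖ₑ = ‖F‖ₑ * ‖(((‖F‖⁻¹ : ℝ) : 𝕜) • F) (x i)‖ₑ := by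
    intro i
    conv_lhs => rw [h2]
    rw [smul_apply, smul_eq_mul, enorm_mul]
    congr 1
    rw [enorm_eq_iff_norm_eq]
    simp
  rw [Finset.sum_congr rfl fun i _ => h3 i, ← Finset.mul_sum]
  gcongr
  exact le_iSup₂_of_le _ h1 le_rfl

/-- Evaluation at `v` is an element of the bidual of norm at most `‖v‖`. -/
lemma sum_enorm_dual_apply_le (v : X) {n : ℕ} (f : Fin n → StrongDual 𝕜 X) :
    ∑ i, ‖f i v‖ₑ ≤ ‖v‖ₑ * weakL1Norm 𝕜 f := by
  refine (sum_enorm_apply_le_weakL1Norm (NormedSpace.inclusionInDoubleDual 𝕜 X v) f).trans ?_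
  gcongr
  exact enorm_le_iff_norm_le.2 (NormedSpace.double_dual_bound 𝕜 X v)

lemma weakL1Norm_ne_top {n : ℕ} (x : Fin n → X) : weakL1Norm 𝕜 x ≠ ∞ := by
  refine ne_top_of_le_ne_top (b := ∑ i, ‖x i‖ₑ) (by simp) ?_
  refine iSup₂_le fun f hf => Finset.sum_le_sum fun i _ => ?_
  refine enorm_le_iff_norm_le.2 ((f.le_opNorm _).trans ?_)
  exact mul_le_of_le_one_left (norm_nonneg _) hf

end Weak

/-! ### Domination of `π₁(T*)` by the `ℓ`-norm, and the first claim -/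

section Part

variable {𝕜 X : Type*} [RCLike 𝕜] [NormedAddCommGroup X] [NormedSpace 𝕜 X]

/-- By Riesz representation the values on the unit vectors are, up to conjugation, the coordinates
of a vector with the same norm. -/
lemma tendsto_enorm_coord (φ : StrongDual 𝕜 (Ell2 𝕜)) :
    Tendsto (fun N => ‖(WithLp.toLp 2 fun j : Fin N => φ (unitVec 𝕜 j) :
      EuclideanSpace 𝕜 (Fin N))‖ₑ) atTop (𝓝 ‖φ‖ₑ) := by
  obtain ⟨w, rfl⟩ := (InnerProductSpace.toDual 𝕜 (Ell2 𝕜)).surjective φ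
  have h1 : ∀ j, ‖InnerProductSpace.toDual 𝕜 (Ell2 𝕜) w (unitVec 𝕜 j)‖ = ‖w j‖ := by
    intro j
    rw [InnerProductSpace.toDual_apply_apply, unitVec, lp.inner_single_right]
    simp
  have h2 : HasSum (fun j => ‖w j‖ ^ 2) (‖w‖ ^ 2) := by
    simpa using lp.hasSum_norm (p := 2) (by norm_num) w
  have h3 := (Real.continuous_sqrt.tendsto _).comp h2.tendsto_sum_nat
  rw [Real.sqrt_sq (norm_nonneg _)] at h3
  have h4 := (ENNReal.continuous_ofReal.tendsto _).comp h3
  rw [← ofReal_norm, LinearIsometryEquiv.norm_map]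
  refine h4.congr fun N => ?_
  simp only [Function.comp]
  rw [← ofReal_norm, EuclideanSpace.norm_eq]
  simp only [h1]
  rw [Finset.sum_range (fun j => ‖w j‖ ^ 2)]

lemma measurable_gaussian_coord (j : ℕ) : StronglyMeasurable (fun ω : ℕ → ℝ => ((ω j : ℝ) : 𝕜)) :=
  (RCLike.continuous_ofReal.comp (continuous_apply j)).stronglyMeasurable

lemma stronglyMeasurable_gaussianPartialSum (T : Ell2 𝕜 →L[𝕜] X) (N : ℕ) :
    StronglyMeasurable (gaussianPartialSum T N) := by
  unfold gaussianPartialSum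
  exact Finset.stronglyMeasurable_fun_sum _ fun j _ => (measurable_gaussian_coord j).smul_const _

/-- First moments are at most second moments on a probability space. The error term is kept because
it tends to zero with `N`. -/
lemma lintegral_enorm_gaussianPartialSum_le (T : Ell2 𝕜 →L[𝕜] X) {f : (ℕ → ℝ) → X}
    (hf : IsGaussianSum T f) (N : ℕ) :
    ∫⁻ ω, ‖gaussianPartialSum T N ω‖ₑ ∂gaussianSeq ≤
      eLpNorm (fun ω => gaussianPartialSum T N ω - f ω) 2 gaussianSeq +
        eLpNorm f 2 gaussianSeq := by
  have hm := (stronglyMeasurable_gaussianPartialSum T N).aestronglyMeasurable (μ := gaussianSeq)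
  rw [← eLpNorm_one_eq_lintegral_enorm]
  refine (eLpNorm_le_eLpNorm_of_exponent_le one_le_two hm).trans ?_
  have := eLpNorm_add_le (hm.sub hf.1.1) hf.1.1 one_le_two (p := 2)
  rwa [sub_add_cancel] at this

/-- The functionals live on `E`, whereas the sum `f` of the series is only known to take values in
`X`. They are therefore applied to the partial sums, which lie in `E`, and `N → ∞` is taken in the
final numerical bound. -/
lemma sum_enorm_adj_le (E : Submodule 𝕜 X) (T : Ell2 𝕜 →L[𝕜] E) {f : (ℕ → ℝ) → X}
    (hf : IsGaussianSum (E.subtypeL ∘L T) f) {n : ℕ} (φ : Fin n → StrongDual 𝕜 E) :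
    ∑ i, ‖adj T (φ i)‖ₑ ≤ khintchineConst * eLpNorm f 2 gaussianSeq * weakL1Norm 𝕜 φ := by
  have hlim : Tendsto (fun N => ∑ i, ‖(WithLp.toLp 2 fun j : Fin N => adj T (φ i) (unitVec 𝕜 j) :
      EuclideanSpace 𝕜 (Fin N))‖ₑ) atTop (𝓝 (∑ i, ‖adj T (φ i)‖ₑ)) :=
    tendsto_finsetSum _ fun i _ => tendsto_enorm_coord _
  have hlim2 : Tendsto (fun N => khintchineConst *
      (eLpNorm (fun ω => gaussianPartialSum (E.subtypeL ∘L T) N ω - f ω) 2 gaussianSeq +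
        eLpNorm f 2 gaussianSeq) * weakL1Norm 𝕜 φ) atTop
      (𝓝 (khintchineConst * (0 + eLpNorm f 2 gaussianSeq) * weakL1Norm 𝕜 φ)) :=
    ENNReal.Tendsto.mul_const (ENNReal.Tendsto.const_mul (hf.2.add tendsto_const_nhds)
      (Or.inr ENNReal.coe_ne_top)) (Or.inr (weakL1Norm_ne_top φ))
  rw [zero_add] at hlim2
  refine le_of_tendsto_of_tendsto' hlim hlim2 fun N => ?_
  calc ∑ i, ‖(WithLp.toLp 2 fun j : Fin N => adj T (φ i) (unitVec 𝕜 j) :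
      EuclideanSpace 𝕜 (Fin N))‖ₑ
      ≤ ∑ i, khintchineConst * ∫⁻ ω, ‖φ i (gaussianPartialSum T N ω)‖ₑ ∂gaussianSeq := by
        refine Finset.sum_le_sum fun i _ => (enorm_le_lintegral_gaussian_sum _).trans
          (le_of_eq ?_)
        congr 1
        refine lintegral_congr fun ω => ?_
        simp [gaussianPartialSum, adj, map_sum, Finset.sum_range]
    _ = khintchineConst * ∫⁻ ω, ∑ i, ‖φ i (gaussianPartialSum T N ω)‖ₑ ∂gaussianSeq := by
        rw [← Finset.mul_sum, lintegral_finsetSum]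
        intro i _
        exact ((φ i).continuous.comp_stronglyMeasurable
          (stronglyMeasurable_gaussianPartialSum T N)).enorm
    _ ≤ khintchineConst * ∫⁻ ω, ‖gaussianPartialSum (E.subtypeL ∘L T) N ω‖ₑ * weakL1Norm 𝕜 φ
          ∂gaussianSeq := by
        refine mul_le_mul_right (lintegral_mono fun ω => ?_) _
        refine (sum_enorm_dual_apply_le _ _).trans (le_of_eq ?_)
        congr 1
        -- The inclusion of `E` in `X` is isometric, so the partial sums have the same norm in both
        -- spaces.
        rw [enorm_eq_iff_norm_eq]
        change ‖((gaussianPartialSum T N ω : E) : X)‖ = _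
        congr 1
        simp [gaussianPartialSum]
    _ = khintchineConst * (∫⁻ ω, ‖gaussianPartialSum (E.subtypeL ∘L T) N ω‖ₑ ∂gaussianSeq)
          * weakL1Norm 𝕜 φ := by
        rw [lintegral_mul_const', mul_assoc]
        exact weakL1Norm_ne_top φ
    _ ≤ _ := by
        gcongr
        exact lintegral_enorm_gaussianPartialSum_le _ hf N

lemma piOne_adj_le (E : Submodule 𝕜 X) (T : Ell2 𝕜 →L[𝕜] E) :
    piOne (adj T) ≤ khintchineConst * ellNorm (E.subtypeL ∘L T) := by
  -- If no Gaussian sum exists the infimum is `∞`; a nonzero constant is needed for the product to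
  -- be `∞` as well.
  have hk : (khintchineConst : ℝ≥0∞) ≠ 0 := by simpa using khintchineConst_ne_zero
  unfold ellNorm
  rw [ENNReal.mul_iInf_of_ne hk ENNReal.coe_ne_top]
  refine le_iInf fun f => ?_
  rw [ENNReal.mul_iInf_of_ne hk ENNReal.coe_ne_top]
  refine le_iInf fun hf => ?_
  have hfin : khintchineConst * eLpNorm f 2 gaussianSeq ≠ ∞ :=
    ENNReal.mul_ne_top ENNReal.coe_ne_top hf.1.eLpNorm_ne_top
  rw [← ENNReal.coe_toNNReal hfin]
  refine iInf₂_le _ fun n φ => ?_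
  rw [ENNReal.coe_toNNReal hfin]
  exact sum_enorm_adj_le E T hf φ

lemma isFiniteRank_subtypeL_comp (E : Submodule 𝕜 X) {T : Ell2 𝕜 →L[𝕜] E} (hT : IsFiniteRank T) :
    IsFiniteRank (E.subtypeL ∘L T) := by
  unfold IsFiniteRank at *
  have : LinearMap.range ((E.subtypeL ∘L T : Ell2 𝕜 →L[𝕜] X) : Ell2 𝕜 →ₗ[𝕜] X)
      = (LinearMap.range (T : Ell2 𝕜 →ₗ[𝕜] E)).map E.subtype := by
    rw [← LinearMap.range_comp]; rfl
  rw [this]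
  infer_instance

lemma piOne_adj_le_of_gap {K : ℝ≥0}
    (hK : ∀ T : Ell2 𝕜 →L[𝕜] X, IsFiniteRank T → ellNorm T ≤ K * piOne (adj T))
    (E : Submodule 𝕜 X) (T : Ell2 𝕜 →L[𝕜] E) (hT : IsFiniteRank T) :
    piOne (adj T) ≤ (khintchineConst * K : ℝ≥0) * piOne (adj T ∘L quotMap E) := by
  refine (piOne_adj_le E T).trans ?_
  rw [ENNReal.coe_mul, mul_assoc]
  gcongr
  -- The adjoint of `E.subtypeL ∘L T` is `adj T ∘L quotMap E` by definition.
  exact hK _ (isFiniteRank_subtypeL_comp E hT)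

end Part

/-! ### The trace estimate for operators factoring through `L₁` -/

section VectorL1

variable {𝕜 : Type*} [RCLike 𝕜] {Ω : Type*} [MeasurableSpace Ω] {ν : Measure Ω}

lemma norm_coord_le (y : Ell2 𝕜) (N : ℕ) :
    ‖(WithLp.toLp 2 fun j : Fin N => y j : EuclideanSpace 𝕜 (Fin N))‖ ≤ ‖y‖ := by
  have h2 : HasSum (fun j => ‖y j‖ ^ 2) (‖y‖ ^ 2) := by
    simpa using lp.hasSum_norm (p := 2) (by norm_num) y
  refine le_of_sq_le_sq ?_ (norm_nonneg _)
  rw [EuclideanSpace.norm_sq_eq]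
  simp only
  rw [← Finset.sum_range (fun j => ‖y j‖ ^ 2)]
  exact h2.summable.sum_le_tsum _ (fun _ _ => sq_nonneg _) |>.trans (le_of_eq h2.tsum_eq)

/-- The bilinear pairing `(y, v) ↦ ∑ yⱼ vⱼ` as a functional of `v`. -/
def coordPairing (N : ℕ) (y : Ell2 𝕜) : EuclideanSpace 𝕜 (Fin N) →L[ℝ] 𝕜 :=
  ∑ j : Fin N, y j • (EuclideanSpace.proj j : EuclideanSpace 𝕜 (Fin N) →L[𝕜] 𝕜).restrictScalars ℝ

lemma coordPairing_apply (N : ℕ) (y : Ell2 𝕜) (v : EuclideanSpace 𝕜 (Fin N)) :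
    coordPairing N y v = ∑ j : Fin N, y j * v j := by
  simp [coordPairing, sum_apply]

lemma norm_coordPairing_le (N : ℕ) (y : Ell2 𝕜) : ‖coordPairing N y‖ ≤ ‖y‖ := by
  refine ContinuousLinearMap.opNorm_le_bound _ (norm_nonneg _) fun v => ?_
  rw [coordPairing_apply]
  refine (norm_sum_le _ _).trans ?_
  simp only [norm_mul]
  refine (Real.sum_mul_le_sqrt_mul_sqrt _ _ _).trans ?_
  have h1 := norm_coord_le y N
  rw [EuclideanSpace.norm_eq] at h1
  rw [EuclideanSpace.norm_eq v]
  gcongr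

open Classical in
/-- The set function `F ↦ B 1_F`, paired with vectors of `𝕜^N`. -/
def indicatorPairing (B : Lp 𝕜 1 ν →L[𝕜] Ell2 𝕜) (N : ℕ) (F : Set Ω) :
    EuclideanSpace 𝕜 (Fin N) →L[ℝ] 𝕜 :=
  if h : MeasurableSet F ∧ ν F ≠ ∞ then
    coordPairing N (B (indicatorConstLp 1 h.1 h.2 (1 : 𝕜))) else 0

lemma coordPairing_add (N : ℕ) (y z : Ell2 𝕜) :
    coordPairing N (y + z) = coordPairing N y + coordPairing N z := by
  ext v
  simp [coordPairing_apply, add_mul, Finset.sum_add_distrib]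

/-- Since `‖B 1_F‖ ≤ ‖B‖ ν(F)`, functions with values in `𝕜^N` can be integrated against the vector
measure `F ↦ B 1_F`. The trace of `B ∘ a` is such an integral, hence controlled by the norm in
`L₁(ν, 𝕜^N)`. -/
lemma dominated_indicatorPairing (B : Lp 𝕜 1 ν →L[𝕜] Ell2 𝕜) (N : ℕ) :
    DominatedFinMeasAdditive ν (indicatorPairing B N) ‖B‖ := by
  refine ⟨fun s t hs ht hμs hμt hst => ?_, fun s hs hμs => ?_⟩
  · have hst' : ν (s ∪ t) ≠ ∞ := (measure_union_lt_top hμs.lt_top hμt.lt_top).ne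
    rw [indicatorPairing, indicatorPairing, indicatorPairing, dif_pos ⟨hs.union ht, hst'⟩,
      dif_pos ⟨hs, hμs⟩, dif_pos ⟨ht, hμt⟩, indicatorConstLp_disjoint_union hs ht hμs hμt hst,
      map_add, coordPairing_add]
  · rw [indicatorPairing, dif_pos ⟨hs, hμs.ne⟩]
    refine (norm_coordPairing_le _ _).trans ((B.le_opNorm _).trans ?_)
    gcongr
    rw [norm_indicatorConstLp one_ne_zero ENNReal.one_ne_top]
    simp

/-- The inclusion of `L₁(ν, 𝕜)` into `L₁(ν, 𝕜^N)` as `j`-th coordinate. -/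
def coordInclusion (ν : Measure Ω) {N : ℕ} (j : Fin N) :
    Lp 𝕜 1 ν →L[ℝ] Lp (EuclideanSpace 𝕜 (Fin N)) 1 ν :=
  ContinuousLinearMap.compLpL 1 ν
    ((ContinuousLinearMap.toSpanSingleton 𝕜 (EuclideanSpace.single j (1 : 𝕜))).restrictScalars ℝ)

/-- Both sides are additive and continuous in `a`, and on `c 1_s` both equal `c (B 1_s)ⱼ`. -/
lemma setToL1_coordInclusion (B : Lp 𝕜 1 ν →L[𝕜] Ell2 𝕜) {N : ℕ} (j : Fin N) (a : Lp 𝕜 1 ν) :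
    L1.setToL1 (dominated_indicatorPairing B N) (coordInclusion ν j a) = B a j := by
  have hc : Continuous fun a : Lp 𝕜 1 ν => B a j :=
    (((lp.evalCLM 𝕜 (fun _ : ℕ => 𝕜) 2 (j : ℕ)) ∘L B).continuous)
  refine Lp.induction ENNReal.one_ne_top
    (motive := fun a => L1.setToL1 (dominated_indicatorPairing B N) (coordInclusion ν j a) = B a j)
    ?_ ?_ ?_ a
  · intro c s hs hμs
    have h1 : (Lp.simpleFunc.indicatorConst 1 hs hμs.ne c : Lp 𝕜 1 ν) =
        c • indicatorConstLp 1 hs hμs.ne (1 : 𝕜) := by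
      rw [Lp.simpleFunc.coe_indicatorConst]
      refine Lp.ext ?_
      filter_upwards [indicatorConstLp_coeFn (p := 1) (hs := hs) (hμs := hμs.ne) (c := c),
        indicatorConstLp_coeFn (p := 1) (hs := hs) (hμs := hμs.ne) (c := (1 : 𝕜)),
        Lp.coeFn_smul c (indicatorConstLp 1 hs hμs.ne (1 : 𝕜))] with x hx1 hx2 hx3
      rw [hx1, hx3, Pi.smul_apply, hx2]
      by_cases hx : x ∈ s <;> simp [hx]
    have h2 : coordInclusion ν j (Lp.simpleFunc.indicatorConst 1 hs hμs.ne c : Lp 𝕜 1 ν) =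
        indicatorConstLp 1 hs hμs.ne (c • EuclideanSpace.single j (1 : 𝕜)) := by
      rw [Lp.simpleFunc.coe_indicatorConst]
      refine Lp.ext ?_
      refine (ContinuousLinearMap.coeFn_compLpL _ _).trans ?_
      filter_upwards [indicatorConstLp_coeFn (p := 1) (hs := hs) (hμs := hμs.ne) (c := c),
        indicatorConstLp_coeFn (p := 1) (hs := hs) (hμs := hμs.ne)
          (c := c • (EuclideanSpace.single j (1 : 𝕜) : EuclideanSpace 𝕜 (Fin N)))] with x hx1 hx2
      rw [hx1, hx2]
      by_cases hx : x ∈ s <;> simp [hx]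
    rw [h2, L1.setToL1_indicatorConstLp _ hs hμs.ne, indicatorPairing, dif_pos ⟨hs, hμs.ne⟩,
      coordPairing_apply, h1, map_smul]
    simp [mul_comm]
  · intro f g hf hg _ h1 h2
    rw [map_add, map_add, map_add, h1, h2]; rfl
  · exact isClosed_eq (by fun_prop) hc

/-- `L₁(ν) ⊗_π ℓ₂ = L₁(ν, ℓ₂)`: the trace of `B ∘ a` is dominated by the norm of `a` in
`L₁(ν, ℓ₂)`. -/
lemma enorm_trace_le (B : Lp 𝕜 1 ν →L[𝕜] Ell2 𝕜) {N : ℕ} (a : Fin N → Lp 𝕜 1 ν) :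
    ‖∑ j, B (a j) j‖ₑ ≤ ‖B‖ₑ * ∫⁻ s, ‖(WithLp.toLp 2 fun j => a j s :
      EuclideanSpace 𝕜 (Fin N))‖ₑ ∂ν := by
  have h1 : ∑ j, B (a j) j = L1.setToL1 (dominated_indicatorPairing B N)
      (∑ j, coordInclusion ν j (a j)) := by
    rw [map_sum]
    exact Finset.sum_congr rfl fun j _ => (setToL1_coordInclusion B j (a j)).symm
  have h2 : ∀ᵐ s ∂ν, (∑ j, coordInclusion ν j (a j) : Lp (EuclideanSpace 𝕜 (Fin N)) 1 ν) s
      = WithLp.toLp 2 fun j => a j s := by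
    have h3 : ∀ᵐ s ∂ν, ∀ j, coordInclusion ν j (a j) s = a j s • EuclideanSpace.single j 1 :=
      ae_all_iff.2 fun j => ContinuousLinearMap.coeFn_compLpL _ (a j)
    filter_upwards [h3, Lp.coeFn_finsetSum Finset.univ fun j => coordInclusion ν j (a j)]
      with s hs1 hs2
    rw [hs2, Finset.sum_apply]
    simp only [hs1]
    ext i
    simp [Pi.single_apply]
  have h3 := L1.norm_setToL1_le_mul_norm (dominated_indicatorPairing B N) (norm_nonneg B)
      (∑ j, coordInclusion ν j (a j))
  rw [← h1] at h3
  calc ‖∑ j, B (a j) j‖ₑ ≤ ENNReal.ofReal (‖B‖ * ‖∑ j, coordInclusion ν j (a j)‖) := by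
        rw [← ofReal_norm]; exact ENNReal.ofReal_le_ofReal h3
    _ = ‖B‖ₑ * ‖∑ j, coordInclusion ν j (a j)‖ₑ := by
        rw [ENNReal.ofReal_mul (norm_nonneg _), ofReal_norm, ofReal_norm]
    _ = _ := by
        rw [Lp.enorm_def, eLpNorm_one_eq_lintegral_enorm]
        congr 1
        exact lintegral_congr_ae (h2.mono fun s hs => by simp only [hs])

/-- The scalar Gaussian inequality is applied at each point `s`, and then the integrals are
exchanged. -/
lemma lintegral_enorm_coord_le {N : ℕ} (a : Fin N → Lp 𝕜 1 ν) :
    ∫⁻ s, ‖(WithLp.toLp 2 fun j => a j s : EuclideanSpace 𝕜 (Fin N))‖ₑ ∂ν ≤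
      khintchineConst * ∫⁻ ω, ‖∑ j : Fin N, ((ω j : ℝ) : 𝕜) • a j‖ₑ ∂gaussianSeq := by
  set h : Ω → EuclideanSpace 𝕜 (Fin N) := fun s => WithLp.toLp 2 fun j => a j s with hh
  have hint : Integrable h ν := by
    have h1 : h = fun s => ∑ j, a j s • (EuclideanSpace.single j (1 : 𝕜) :
        EuclideanSpace 𝕜 (Fin N)) := by
      funext s; ext i; simp [hh, Pi.single_apply]
    rw [h1]
    exact integrable_finsetSum _ fun j _ => (L1.integrable_coeFn (a j)).smul_const _
  have hfin := hint.aefinStronglyMeasurable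
  -- The measure `ν` is arbitrary. Tonelli becomes available after restriction to a σ-finite set
  -- outside which the integrable function `h` vanishes almost everywhere.
  set t := hfin.sigmaFiniteSet with ht
  have hsf : SigmaFinite (ν.restrict t) := hfin.sigmaFinite_restrict
  have h0 : ∫⁻ s, ‖h s‖ₑ ∂ν = ∫⁻ s, ‖h s‖ₑ ∂(ν.restrict t) := by
    rw [← lintegral_add_compl _ hfin.measurableSet]
    have : ∫⁻ s in tᶜ, ‖h s‖ₑ ∂ν = 0 := by
      rw [lintegral_eq_zero_iff' (hint.aestronglyMeasurable.enorm.restrict)]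
      filter_upwards [hfin.ae_eq_zero_compl] with s hs
      simp [hs]
    rw [this, add_zero]
  have hmeas : Measurable fun p : Ω × (ℕ → ℝ) => ‖∑ j : Fin N, ((p.2 j : ℝ) : 𝕜) * a j p.1‖ₑ := by
    refine Measurable.enorm (Finset.measurable_fun_sum _ fun j _ => Measurable.mul ?_ ?_)
    · exact RCLike.measurable_ofReal.comp ((measurable_pi_apply _).comp measurable_snd)
    · exact (Lp.stronglyMeasurable (a j)).measurable.comp measurable_fst
  rw [h0]
  calc ∫⁻ s, ‖h s‖ₑ ∂(ν.restrict t)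
      ≤ ∫⁻ s, khintchineConst * ∫⁻ ω, ‖∑ j : Fin N, ((ω j : ℝ) : 𝕜) * a j s‖ₑ ∂gaussianSeq
          ∂(ν.restrict t) := lintegral_mono fun s => enorm_le_lintegral_gaussian_sum (h s)
    _ = khintchineConst * ∫⁻ ω, ∫⁻ s, ‖∑ j : Fin N, ((ω j : ℝ) : 𝕜) * a j s‖ₑ ∂(ν.restrict t)
          ∂gaussianSeq := by
        rw [lintegral_const_mul' _ _ ENNReal.coe_ne_top, lintegral_lintegral_swap]
        exact hmeas.aemeasurable
    _ ≤ _ := by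
        refine mul_le_mul_right (lintegral_mono fun ω => ?_) _
        refine (lintegral_mono' Measure.restrict_le_self le_rfl).trans (le_of_eq ?_)
        rw [Lp.enorm_def, eLpNorm_one_eq_lintegral_enorm]
        refine lintegral_congr_ae ?_
        have h3 : ∀ᵐ s ∂ν, ∀ j : Fin N, (((ω j : ℝ) : 𝕜) • a j) s = ((ω j : ℝ) : 𝕜) * a j s :=
          ae_all_iff.2 fun j => Lp.coeFn_smul _ (a j)
        filter_upwards [h3, Lp.coeFn_finsetSum Finset.univ fun j : Fin N => ((ω j : ℝ) : 𝕜) • a j]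
          with s hs1 hs2
        rw [hs2, Finset.sum_apply]
        simp only [hs1]

lemma enorm_trace_comp_le {E : Type*} [NormedAddCommGroup E] [NormedSpace 𝕜 E]
    (A : E →L[𝕜] Lp 𝕜 1 ν) (B : Lp 𝕜 1 ν →L[𝕜] Ell2 𝕜) {N : ℕ} (x : Fin N → E) :
    ‖∑ j, B (A (x j)) j‖ₑ ≤ khintchineConst *
      (∫⁻ ω, ‖∑ j : Fin N, ((ω j : ℝ) : 𝕜) • x j‖ₑ ∂gaussianSeq) * (‖A‖ₑ * ‖B‖ₑ) := by
  refine (enorm_trace_le B _).trans ?_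
  have h1 : ∫⁻ ω, ‖∑ j : Fin N, ((ω j : ℝ) : 𝕜) • A (x j)‖ₑ ∂gaussianSeq ≤
      ‖A‖ₑ * ∫⁻ ω, ‖∑ j : Fin N, ((ω j : ℝ) : 𝕜) • x j‖ₑ ∂gaussianSeq := by
    rw [← lintegral_const_mul' _ _ enorm_ne_top]
    refine lintegral_mono fun ω => ?_
    simp only [← map_smul, ← map_sum]
    exact A.le_opENorm _
  calc _ ≤ ‖B‖ₑ * (khintchineConst * (‖A‖ₑ *
        ∫⁻ ω, ‖∑ j : Fin N, ((ω j : ℝ) : 𝕜) • x j‖ₑ ∂gaussianSeq)) :=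
        mul_le_mul_right ((lintegral_enorm_coord_le _).trans (mul_le_mul_right h1 _)) _
    _ = _ := by ring

end VectorL1

open scoped TensorProduct

/-! ### The projective seminorm, and Hahn-Banach along a linear map -/

section Projective

variable {𝕜 X C : Type*} [RCLike 𝕜] [NormedAddCommGroup X] [NormedSpace 𝕜 X]
  [NormedAddCommGroup C] [NormedSpace 𝕜 C]

/-- The element of `X ⊗ C` represented by a multiset of pairs. -/
def tensorSum (l : Multiset (X × C)) : X ⊗[𝕜] C := (l.map fun q => q.1 ⊗ₜ[𝕜] q.2).sum

/-- The projective cost of a multiset of pairs. -/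
def tensorCost (l : Multiset (X × C)) : ℝ := (l.map fun q => ‖q.1‖ * ‖q.2‖).sum

lemma tensorCost_nonneg (l : Multiset (X × C)) : 0 ≤ tensorCost l :=
  Multiset.sum_nonneg fun r hr => by
    obtain ⟨q, -, rfl⟩ := Multiset.mem_map.1 hr
    positivity

/-- The costs of all representations of a tensor. -/
def tensorCosts (u : X ⊗[𝕜] C) : Set ℝ :=
  {r | ∃ l : Multiset (X × C), tensorSum (𝕜 := 𝕜) l = u ∧ tensorCost l = r}

lemma bddBelow_tensorCosts (u : X ⊗[𝕜] C) : BddBelow (tensorCosts u) :=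
  ⟨0, by rintro r ⟨l, -, rfl⟩; exact tensorCost_nonneg l⟩

lemma tensorCosts_nonempty (u : X ⊗[𝕜] C) : (tensorCosts u).Nonempty := by
  obtain ⟨l, hl⟩ := TensorProduct.exists_multiset u
  exact ⟨_, l, hl.symm, rfl⟩

variable (𝕜 X C) in
/-- The projective seminorm on `X ⊗ C`. -/
def projSeminorm : Seminorm 𝕜 (X ⊗[𝕜] C) :=
  Seminorm.ofSMulLE (fun u => sInf (tensorCosts u))
    (le_antisymm (csInf_le (bddBelow_tensorCosts _) ⟨0, by simp [tensorSum], by simp [tensorCost]⟩)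
      (le_csInf (tensorCosts_nonempty _) (by rintro r ⟨l, -, rfl⟩; exact tensorCost_nonneg l)))
    (by
      intro u v
      refine le_of_forall_pos_le_add fun ε hε => ?_
      obtain ⟨_, ⟨l, hl, rfl⟩, hl2⟩ :=
        exists_lt_of_csInf_lt (tensorCosts_nonempty u) (lt_add_of_pos_right _ (half_pos hε))
      obtain ⟨_, ⟨m, hm, rfl⟩, hm2⟩ :=
        exists_lt_of_csInf_lt (tensorCosts_nonempty v) (lt_add_of_pos_right _ (half_pos hε))
      have : sInf (tensorCosts (u + v)) ≤ tensorCost l + tensorCost m :=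
        csInf_le (bddBelow_tensorCosts _) ⟨l + m, by rw [← hl, ← hm]; simp [tensorSum],
          by simp [tensorCost]⟩
      linarith)
    (by
      intro c u
      rcases (norm_nonneg c).eq_or_lt with h | h
      · have hc : c = 0 := norm_eq_zero.1 h.symm
        subst hc
        simp only [zero_smul, norm_zero, zero_mul]
        exact csInf_le (bddBelow_tensorCosts _) ⟨0, by simp [tensorSum], by simp [tensorCost]⟩
      · rw [← div_le_iff₀' h]
        refine le_csInf (tensorCosts_nonempty u) ?_
        rintro _ ⟨l, hl, rfl⟩
        rw [div_le_iff₀' h]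
        refine csInf_le (bddBelow_tensorCosts _) ⟨l.map fun q => (c • q.1, q.2), ?_, ?_⟩
        · rw [← hl]
          simp [tensorSum, Multiset.map_map, Multiset.smul_sum, TensorProduct.smul_tmul',
            Function.comp_def]
        · simp [tensorCost, Multiset.map_map, norm_smul, mul_assoc, Multiset.sum_map_mul_left])

lemma projSeminorm_apply (u : X ⊗[𝕜] C) : projSeminorm 𝕜 X C u = sInf (tensorCosts u) := rfl

lemma projSeminorm_tmul_le (x : X) (f : C) : projSeminorm 𝕜 X C (x ⊗ₜ f) ≤ ‖x‖ * ‖f‖ :=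
  csInf_le (bddBelow_tensorCosts _) ⟨{(x, f)}, by simp [tensorSum], by simp [tensorCost]⟩

end Projective

/-- Hahn-Banach extension along a linear map. -/
lemma exists_extension_along {𝕜 U V : Type*} [RCLike 𝕜] [AddCommGroup U] [Module 𝕜 U]
    [AddCommGroup V] [Module 𝕜 V] (p : Seminorm 𝕜 V) (j : U →ₗ[𝕜] V) (φ : U →ₗ[𝕜] 𝕜)
    (h : ∀ u, ‖φ u‖ ≤ p (j u)) :
    ∃ Φ : V →ₗ[𝕜] 𝕜, (∀ u, Φ (j u) = φ u) ∧ ∀ v, ‖Φ v‖ ≤ p v := by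
  -- `j` need not be injective; the bound by `p ∘ j` is what lets `φ` descend to the range of `j`.
  have hker : LinearMap.ker j ≤ LinearMap.ker φ := by
    intro u hu
    have := h u
    rw [LinearMap.mem_ker.1 hu, map_zero] at this
    exact LinearMap.mem_ker.2 (norm_le_zero_iff.1 this)
  let f : Module.Dual 𝕜 (LinearMap.range j) :=
    ((LinearMap.ker j).liftQ φ hker) ∘ₗ j.quotKerEquivRange.symm.toLinearMap
  have hf : ∀ u, f ⟨j u, u, rfl⟩ = φ u := by
    intro u
    have : j.quotKerEquivRange.symm ⟨j u, u, rfl⟩ = (LinearMap.ker j).mkQ u := by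
      rw [LinearEquiv.symm_apply_eq]; rfl
    simp only [f, LinearMap.comp_apply, LinearEquiv.coe_coe, this]
    simp
  obtain ⟨g, hg, hle⟩ := Module.Dual.exists_extension_of_le_seminorm (LinearMap.range j) f
    (p := p) (by rintro ⟨_, u, rfl⟩; rw [hf]; exact h u)
  exact ⟨g, fun u => (hg ⟨j u, u, rfl⟩).trans (hf u), hle⟩

/-! ### The weakly compact unit ball of `ℓ₂` -/

section Ball

variable {𝕜 : Type*} [RCLike 𝕜]

variable (𝕜) in
/-- The closed unit ball of `ℓ₂` as a set of sequences; with the product topology it is the unit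
ball with its weak topology. -/
def ballSet : Set (ℕ → 𝕜) := {y | ∀ N, ∑ j ∈ Finset.range N, ‖y j‖ ^ 2 ≤ 1}

lemma isClosed_ballSet : IsClosed (ballSet 𝕜) := by
  rw [ballSet, Set.ofPred_forall]
  exact isClosed_iInter fun N => isClosed_le (by fun_prop) continuous_const

lemma isCompact_ballSet : IsCompact (ballSet 𝕜) := by
  refine (isCompact_univ_pi (X := fun _ : ℕ => 𝕜)
    fun _ => isCompact_closedBall (0 : 𝕜) 1).of_isClosed_subset isClosed_ballSet ?_
  intro y hy j _
  rw [mem_closedBall_zero_iff]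
  have h1 := hy (j + 1)
  rw [Finset.sum_range_succ] at h1
  have h2 : 0 ≤ ∑ j ∈ Finset.range j, ‖y j‖ ^ 2 := by positivity
  nlinarith [norm_nonneg (y j)]

instance : CompactSpace (ballSet 𝕜) := isCompact_iff_compactSpace.1 isCompact_ballSet

/-- The `j`-th coordinate as a continuous function on the ball. -/
def coordFun (j : ℕ) : C(ballSet 𝕜, 𝕜) :=
  ⟨fun y => y.1 j, (continuous_apply j).comp continuous_subtype_val⟩

/-- A vector of norm at most one as a point of the ball. -/
def toBall (v : Ell2 𝕜) (hv : ‖v‖ ≤ 1) : ballSet 𝕜 :=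
  ⟨fun j => v j, fun N => by
    have h2 : HasSum (fun j => ‖v j‖ ^ 2) (‖v‖ ^ 2) := by
      simpa using lp.hasSum_norm (p := 2) (by norm_num) v
    refine (sum_le_hasSum _ (fun _ _ => sq_nonneg _) h2).trans ?_
    exact pow_le_one₀ (norm_nonneg _) hv⟩

end Ball

/-! ### From GAP to an operator `X → C(B₂)*` extending `S` -/

section Extension

variable {𝕜 : Type*} {X : Type u} [RCLike 𝕜] [NormedAddCommGroup X] [NormedSpace 𝕜 X]

/-- The finite rank operator `∑_{j < N} eⱼ ⊗ xⱼ`. -/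
def finiteOp {N : ℕ} (x : Fin N → X) : Ell2 𝕜 →L[𝕜] X :=
  ∑ j : Fin N, (lp.evalCLM 𝕜 (fun _ : ℕ => 𝕜) 2 (j : ℕ)).smulRight (x j)

lemma finiteOp_apply {N : ℕ} (x : Fin N → X) (v : Ell2 𝕜) :
    finiteOp x v = ∑ j : Fin N, v j • x j := by
  simp [finiteOp, sum_apply]; rfl

lemma isFiniteRank_finiteOp {N : ℕ} (x : Fin N → X) :
    IsFiniteRank (finiteOp (𝕜 := 𝕜) x) := by
  have hle : LinearMap.range (finiteOp (𝕜 := 𝕜) x : Ell2 𝕜 →ₗ[𝕜] X) ≤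
      Submodule.span 𝕜 (Set.range x) := by
    rintro _ ⟨v, rfl⟩
    change finiteOp x v ∈ _
    rw [finiteOp_apply]
    exact Submodule.sum_mem _ fun j _ => Submodule.smul_mem _ _ (Submodule.subset_span ⟨j, rfl⟩)
  have : FiniteDimensional 𝕜 (Submodule.span 𝕜 (Set.range x)) :=
    FiniteDimensional.span_of_finite 𝕜 (Set.finite_range x)
  exact Submodule.finiteDimensional_of_le hle

lemma gaussianPartialSum_finiteOp {N : ℕ} (x : Fin N → X) (ω : ℕ → ℝ) {n : ℕ} (hn : N ≤ n) :
    gaussianPartialSum (finiteOp (𝕜 := 𝕜) x) n ω = ∑ j : Fin N, ((ω j : ℝ) : 𝕜) • x j := by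
  have h1 : ∀ j, finiteOp (𝕜 := 𝕜) x (unitVec 𝕜 j) = if h : j < N then x ⟨j, h⟩ else 0 := by
    intro j
    rw [finiteOp_apply]
    split_ifs with h
    · rw [Finset.sum_eq_single ⟨j, h⟩]
      · simp [unitVec]
      · intro i _ hi
        have : (i : ℕ) ≠ j := fun h' => hi (Fin.ext h')
        simp [unitVec, lp.single_apply, this]
      · simp
    · refine Finset.sum_eq_zero fun i _ => ?_
      have : (i : ℕ) ≠ j := fun h' => h (h' ▸ i.2)
      simp [unitVec, lp.single_apply, this]
  unfold gaussianPartialSum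
  simp only [h1]
  rw [← Finset.sum_subset (Finset.range_mono hn), Finset.sum_range]
  · simp
  · intro j _ hj
    rw [dif_neg (by simpa using hj), smul_zero]

/-- The partial sums are constant from `N` on, so the first moment of the finite sum is compared
with any `L₂` limit. -/
lemma lintegral_gaussian_le_ellNorm {N : ℕ} (x : Fin N → X) :
    ∫⁻ ω, ‖∑ j : Fin N, ((ω j : ℝ) : 𝕜) • x j‖ₑ ∂gaussianSeq ≤
      ellNorm (finiteOp (𝕜 := 𝕜) x) := by
  refine le_iInf₂ fun f hf => ?_
  have h1 : Tendsto (fun n => eLpNorm (fun ω => gaussianPartialSum (finiteOp (𝕜 := 𝕜) x) n ω - f ω)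
      2 gaussianSeq + eLpNorm f 2 gaussianSeq) atTop (𝓝 (0 + eLpNorm f 2 gaussianSeq)) :=
    hf.2.add tendsto_const_nhds
  rw [zero_add] at h1
  refine ge_of_tendsto h1 ((eventually_ge_atTop N).mono fun n hn => ?_)
  refine le_trans (le_of_eq ?_) (lintegral_enorm_gaussianPartialSum_le _ hf n)
  exact lintegral_congr fun ω => by rw [gaussianPartialSum_finiteOp x ω hn]

/-- Slicing a tensor by a functional on the first factor. -/
def sliceMap {C : Type*} [NormedAddCommGroup C] [NormedSpace 𝕜 C] (φ : StrongDual 𝕜 X) :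
    X ⊗[𝕜] C →ₗ[𝕜] C :=
  TensorProduct.lift ((LinearMap.lsmul 𝕜 C).comp (φ : X →ₗ[𝕜] 𝕜))

lemma norm_sliceMap_le {C : Type*} [NormedAddCommGroup C] [NormedSpace 𝕜 C] (φ : StrongDual 𝕜 X)
    (l : Multiset (X × C)) :
    ‖sliceMap φ (tensorSum (𝕜 := 𝕜) l)‖ₑ ≤ (l.map fun q => ‖φ q.1‖ₑ * ‖q.2‖ₑ).sum := by
  induction l using Multiset.induction_on with
  | empty => simp [tensorSum]
  | cons q l ih =>
    simp only [tensorSum, Multiset.map_cons, Multiset.sum_cons, map_add] at ih ⊢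
    refine (enorm_add_le _ _).trans (add_le_add (le_of_eq ?_) ih)
    simp [sliceMap, enorm_smul]

/-- The adjoint sends `φ` to `v ↦ ∑ vⱼ φ(xⱼ)`, which on the unit ball is the continuous function `∑
φ(xⱼ) coordⱼ`. -/
lemma norm_adj_finiteOp_le {N : ℕ} (x : Fin N → X) (φ : StrongDual 𝕜 X) :
    ‖adj (finiteOp (𝕜 := 𝕜) x) φ‖ ≤
      ‖sliceMap φ (∑ j : Fin N, x j ⊗ₜ[𝕜] (coordFun j : C(ballSet 𝕜, 𝕜)))‖ := by
  have h := ContinuousLinearMap.opNorm_bound_of_ball_bound (r := 1) one_pos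
    ‖sliceMap φ (∑ j : Fin N, x j ⊗ₜ[𝕜] (coordFun j : C(ballSet 𝕜, 𝕜)))‖
    (adj (finiteOp (𝕜 := 𝕜) x) φ) (fun v hv => ?_)
  · simpa using h
  · have hv' : ‖v‖ ≤ 1 := by simpa using hv
    refine le_trans (le_of_eq ?_) (ContinuousMap.norm_coe_le_norm _ (toBall v hv'))
    congr 1
    simp [sliceMap, adj, finiteOp_apply, map_sum, ContinuousMap.sum_apply, coordFun, toBall,
      mul_comm]

/-- A representation `∑ x_q ⊗ f_q` of the tensor gives `‖T*φ‖ ≤ ∑ |φ(x_q)| ‖f_q‖`. Each evaluation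
`φ ↦ φ(x_q)` is 1-summing with norm at most `‖x_q‖`, so `π₁(T*)` is at most the cost of the
representation. -/
lemma piOne_adj_finiteOp_le {N : ℕ} (x : Fin N → X) :
    piOne (adj (finiteOp (𝕜 := 𝕜) x)) ≤ ENNReal.ofReal (projSeminorm 𝕜 X C(ballSet 𝕜, 𝕜)
      (∑ j : Fin N, x j ⊗ₜ[𝕜] (coordFun j : C(ballSet 𝕜, 𝕜)))) := by
  set u := ∑ j : Fin N, x j ⊗ₜ[𝕜] (coordFun j : C(ballSet 𝕜, 𝕜)) with hu
  have key : ∀ r ∈ tensorCosts u, piOne (adj (finiteOp (𝕜 := 𝕜) x)) ≤ ENNReal.ofReal r := by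
    rintro _ ⟨l, hl, rfl⟩
    have hcost : ENNReal.ofReal (tensorCost l) = (l.map fun q => ‖q.1‖ₑ * ‖q.2‖ₑ).sum := by
      clear hl
      induction l using Multiset.induction_on with
      | empty => simp [tensorCost]
      | cons q l ih =>
        have h0 := tensorCost_nonneg l
        simp only [tensorCost, Multiset.map_cons, Multiset.sum_cons] at ih h0 ⊢
        rw [ENNReal.ofReal_add (by positivity) h0, ih, ENNReal.ofReal_mul (norm_nonneg _),
          ofReal_norm, ofReal_norm]
    refine iInf₂_le (tensorCost l).toNNReal fun n φ => ?_
    change _ ≤ ENNReal.ofReal (tensorCost l) * _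
    rw [hcost]
    calc ∑ i, ‖adj (finiteOp (𝕜 := 𝕜) x) (φ i)‖ₑ
        ≤ ∑ i, (l.map fun q => ‖φ i q.1‖ₑ * ‖q.2‖ₑ).sum := by
          refine Finset.sum_le_sum fun i _ => ?_
          rw [← hl] at hu
          refine (enorm_le_iff_norm_le.2 (norm_adj_finiteOp_le x (φ i))).trans ?_
          rw [← hu]
          exact norm_sliceMap_le _ _
      _ ≤ _ := by
          clear hl hcost
          induction l using Multiset.induction_on with
          | empty => simp
          | cons q l ih =>
            simp only [Multiset.map_cons, Multiset.sum_cons, Finset.sum_add_distrib, add_mul]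
            refine add_le_add ?_ ih
            rw [← Finset.sum_mul, mul_right_comm]
            exact mul_le_mul_left (sum_enorm_dual_apply_le _ _) _
  have hfin : piOne (adj (finiteOp (𝕜 := 𝕜) x)) ≠ ∞ := by
    obtain ⟨r, hr⟩ := tensorCosts_nonempty u
    exact ne_top_of_le_ne_top ENNReal.ofReal_ne_top (key r hr)
  rw [← ENNReal.ofReal_toReal hfin, projSeminorm_apply]
  refine ENNReal.ofReal_le_ofReal (le_csInf (tensorCosts_nonempty u) fun r hr => ?_)
  refine ENNReal.toReal_le_of_le_ofReal ?_ (key r hr)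
  obtain ⟨l, -, rfl⟩ := hr
  exact tensorCost_nonneg l

/-- GAP enters the second claim here. The projective norm is computed in `X ⊗ C(B₂)`, although the
vectors lie in `E`; this is what makes the trace functional extendable beyond `E`. -/
lemma enorm_trace_le_gammaOne {K : ℝ≥0}
    (hK : ∀ T : Ell2 𝕜 →L[𝕜] X, IsFiniteRank T → ellNorm T ≤ K * piOne (adj T))
    (E : Submodule 𝕜 X) (S : E →L[𝕜] Ell2 𝕜) (hS : FactorsThroughL1 S) {N : ℕ} (x : Fin N → E) :
    ‖∑ j, S (x j) j‖ₑ ≤ (khintchineConst * K : ℝ≥0) *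
      ENNReal.ofReal (projSeminorm 𝕜 X C(ballSet 𝕜, 𝕜)
        (∑ j : Fin N, (x j : X) ⊗ₜ[𝕜] (coordFun j : C(ballSet 𝕜, 𝕜)))) * gammaOne S := by
  set P := ENNReal.ofReal (projSeminorm 𝕜 X C(ballSet 𝕜, 𝕜)
        (∑ j : Fin N, (x j : X) ⊗ₜ[𝕜] (coordFun j : C(ballSet 𝕜, 𝕜)))) with hP
  have hgauss : ∫⁻ ω, ‖∑ j : Fin N, ((ω j : ℝ) : 𝕜) • x j‖ₑ ∂gaussianSeq ≤ K * P := by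
    have h1 := lintegral_gaussian_le_ellNorm (𝕜 := 𝕜) (fun j => (x j : X))
    refine le_trans (le_of_eq (lintegral_congr fun ω => ?_)) (h1.trans
      ((hK _ (isFiniteRank_finiteOp _)).trans (mul_le_mul_right (piOne_adj_finiteOp_le _) _)))
    rw [enorm_eq_iff_norm_eq]
    change ‖((∑ j : Fin N, ((ω j : ℝ) : 𝕜) • x j : E) : X)‖ = _
    congr 1
    simp
  have hfin : (khintchineConst * K : ℝ≥0) * P ≠ ∞ :=
    ENNReal.mul_ne_top ENNReal.coe_ne_top ENNReal.ofReal_ne_top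
  unfold gammaOne
  -- A vanishing constant commutes with the infimum only if the family is nonempty, which `hS`
  -- provides.
  rw [sInf_eq_iInf', ENNReal.mul_iInf' (fun h => absurd h hfin) (fun _ => ?_)]
  · refine le_iInf ?_
    rintro ⟨_, Ω, _, ν, A, B, rfl, rfl⟩
    refine (enorm_trace_comp_le A B x).trans (mul_le_mul_left ?_ _)
    rw [ENNReal.coe_mul, mul_assoc]
    exact mul_le_mul_right hgauss _
  · obtain ⟨Ω, m, ν, A, B, h⟩ := hS
    exact ⟨⟨_, Ω, m, ν, A, B, h, rfl⟩⟩

/-- The functional `(xⱼ) ↦ ∑ (S xⱼ)ⱼ` on finite sequences in `E` is bounded by the projective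
seminorm of `∑ xⱼ ⊗ coordⱼ`. Its Hahn-Banach extension to `X ⊗ C(B₂)`, read as a bilinear form, is
the operator `A`. -/
lemma exists_dual_operator {K : ℝ≥0}
    (hK : ∀ T : Ell2 𝕜 →L[𝕜] X, IsFiniteRank T → ellNorm T ≤ K * piOne (adj T))
    (E : Submodule 𝕜 X) (S : E →L[𝕜] Ell2 𝕜) (hS : FactorsThroughL1 S) :
    ∃ A : X →L[𝕜] StrongDual 𝕜 C(ballSet 𝕜, 𝕜),
      ‖A‖ₑ ≤ (khintchineConst * K : ℝ≥0) * gammaOne S ∧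
      ∀ (x : E) (j : ℕ), A x (coordFun j) = S x j := by
  have hfin : (khintchineConst * K : ℝ≥0) * gammaOne S ≠ ∞ := by
    obtain ⟨Ω, m, ν, A, B, h⟩ := hS
    refine ENNReal.mul_ne_top ENNReal.coe_ne_top (ne_top_of_le_ne_top
      (ENNReal.mul_ne_top (enorm_ne_top (x := A)) (enorm_ne_top (x := B)))
      (sInf_le ⟨Ω, m, ν, A, B, h, rfl⟩))
  set M : ℝ≥0 := ((khintchineConst * K : ℝ≥0) * gammaOne S).toNNReal with hM
  have hMe : (M : ℝ≥0∞) = (khintchineConst * K : ℝ≥0) * gammaOne S := ENNReal.coe_toNNReal hfin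
  let p := projSeminorm 𝕜 X C(ballSet 𝕜, 𝕜)
  let J : (ℕ →₀ E) →ₗ[𝕜] X ⊗[𝕜] C(ballSet 𝕜, 𝕜) :=
    Finsupp.lsum 𝕜 fun j => ((TensorProduct.mk 𝕜 X C(ballSet 𝕜, 𝕜)).flip (coordFun j)).comp
      E.subtype
  let φ : (ℕ →₀ E) →ₗ[𝕜] 𝕜 :=
    Finsupp.lsum 𝕜 fun j => ((lp.evalCLM 𝕜 (fun _ : ℕ => 𝕜) 2 j ∘L S : E →L[𝕜] 𝕜) : E →ₗ[𝕜] 𝕜)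
  have hb : ∀ u, ‖φ u‖ ≤ (M • p) (J u) := by
    intro u
    obtain ⟨N, hN⟩ := u.support.exists_nat_subset_range
    have h1 : φ u = ∑ j : Fin N, S (u j) j := by
      simp only [φ, Finsupp.lsum_apply]
      rw [Finsupp.sum_of_support_subset u hN _ (by simp), Finset.sum_range]
      rfl
    have h2 : J u = ∑ j : Fin N, (u j : X) ⊗ₜ[𝕜] (coordFun j : C(ballSet 𝕜, 𝕜)) := by
      simp only [J, Finsupp.lsum_apply]
      rw [Finsupp.sum_of_support_subset u hN _ (by simp), Finset.sum_range]
      rfl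
    have h3 := enorm_trace_le_gammaOne hK E S hS (fun j : Fin N => u j)
    rw [← h1, ← h2, mul_right_comm, ← hMe, ← ofReal_norm, ← ENNReal.ofReal_coe_nnreal,
      ← ENNReal.ofReal_mul M.coe_nonneg] at h3
    exact (ENNReal.ofReal_le_ofReal_iff (mul_nonneg M.coe_nonneg (apply_nonneg p _))).1 h3
  obtain ⟨Φ, hΦ, hle⟩ := exists_extension_along (M • p) J φ hb
  refine ⟨LinearMap.mkContinuous₂ (TensorProduct.curry Φ) M fun x f => ?_, ?_, fun x j => ?_⟩
  · refine (hle _).trans ?_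
    rw [mul_assoc]
    exact mul_le_mul_of_nonneg_left (projSeminorm_tmul_le x f) M.coe_nonneg
  · rw [← hMe, ← ofReal_norm, ← ENNReal.ofReal_coe_nnreal]
    exact ENNReal.ofReal_le_ofReal (LinearMap.mkContinuous₂_norm_le _ M.coe_nonneg _)
  · have h1 := hΦ (Finsupp.single j x)
    have h2 : J (Finsupp.single j x) = (x : X) ⊗ₜ[𝕜] coordFun j := by simp [J]
    have h3 : φ (Finsupp.single j x) = S x j := by simp [φ]; rfl
    rw [h2, h3] at h1
    exact h1

end Extension

/-! ### Functionals on `C(K)` as measures -/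

section Variation

variable {𝕜 : Type*} [RCLike 𝕜] {K : Type*} [TopologicalSpace K]

/-- The values `‖Λ g‖` for `|g| ≤ f`. -/
def variationSet (Λ : StrongDual 𝕜 C(K, 𝕜)) (f : K → ℝ≥0) : Set ℝ≥0 :=
  {r | ∃ g : C(K, 𝕜), (∀ y, ‖g y‖₊ ≤ f y) ∧ ‖Λ g‖₊ = r}

/-- The total variation `|Λ|(f) = sup {|Λ g| : |g| ≤ f}` of a functional. -/
def variation (Λ : StrongDual 𝕜 C(K, 𝕜)) (f : K → ℝ≥0) : ℝ≥0 := sSup (variationSet Λ f)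

lemma variation_le {Λ : StrongDual 𝕜 C(K, 𝕜)} {f : K → ℝ≥0} {c : ℝ≥0}
    (h : ∀ g : C(K, 𝕜), (∀ y, ‖g y‖₊ ≤ f y) → ‖Λ g‖₊ ≤ c) : variation Λ f ≤ c :=
  csSup_le ⟨_, 0, by simp, rfl⟩ (by rintro _ ⟨g, hg, rfl⟩; exact h g hg)

variable [CompactSpace K]

lemma nnnorm_apply_le_of_bound (Λ : StrongDual 𝕜 C(K, 𝕜)) {g : C(K, 𝕜)} {c : ℝ≥0}
    (h : ∀ y, ‖g y‖₊ ≤ c) : ‖Λ g‖₊ ≤ ‖Λ‖₊ * c := by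
  refine (Λ.le_opNNNorm g).trans ?_
  gcongr
  exact (ContinuousMap.norm_le g c.coe_nonneg).2 h

lemma bddAbove_variationSet (Λ : StrongDual 𝕜 C(K, 𝕜)) {f : K → ℝ≥0} (hf : Continuous f) :
    BddAbove (variationSet Λ f) := by
  obtain ⟨c, hc⟩ := (isCompact_range hf).bddAbove
  refine ⟨‖Λ‖₊ * c, ?_⟩
  rintro _ ⟨g, hg, rfl⟩
  exact nnnorm_apply_le_of_bound Λ fun y => (hg y).trans (hc ⟨y, rfl⟩)

lemma le_variation (Λ : StrongDual 𝕜 C(K, 𝕜)) {f : K → ℝ≥0} (hf : Continuous f) {g : C(K, 𝕜)}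
    (hg : ∀ y, ‖g y‖₊ ≤ f y) : ‖Λ g‖₊ ≤ variation Λ f :=
  le_csSup (bddAbove_variationSet Λ hf) ⟨g, hg, rfl⟩

/-- For `≤`, a function `g` with `|g| ≤ f₁ + f₂` is split in proportion to `f₁` and `f₂`. For `≥`,
unimodular factors turn `Λ g₁` and `Λ g₂` into nonnegative reals, so that their moduli add up. -/
lemma variation_add (Λ : StrongDual 𝕜 C(K, 𝕜)) {f₁ f₂ : K → ℝ≥0} (h₁ : Continuous f₁)
    (h₂ : Continuous f₂) : variation Λ (f₁ + f₂) = variation Λ f₁ + variation Λ f₂ := by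
  refine le_antisymm ?_ ?_
  · refine variation_le fun g hg => ?_
    refine le_of_forall_pos_le_add fun ε hε => ?_
    -- Dividing by `f₁ + f₂ + δ` keeps the pieces continuous at zeros of `f₁ + f₂`; the third piece,
    -- bounded by `δ`, costs at most `ε`.
    obtain ⟨δ, hδ, hδε⟩ : ∃ δ : ℝ≥0, 0 < δ ∧ ‖Λ‖₊ * δ ≤ ε := by
      refine ⟨ε / (‖Λ‖₊ + 1), by positivity, ?_⟩
      rw [mul_div_assoc', div_le_iff₀ (by positivity), mul_comm]
      gcongr
      exact le_self_add
    have hpos : ∀ y, f₁ y + f₂ y + δ ≠ 0 := fun y => by positivity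
    let part : {f : K → ℝ≥0 // Continuous f} → C(K, 𝕜) := fun f =>
      ⟨fun y => (((f.1 y / (f₁ y + f₂ y + δ) : ℝ≥0) : ℝ) : 𝕜) * g y, by
        have := f.2
        have : Continuous fun y => f.1 y / (f₁ y + f₂ y + δ) := by fun_prop (disch := assumption)
        fun_prop⟩
    have hpart : ∀ f y, ‖part f y‖₊ = f.1 y / (f₁ y + f₂ y + δ) * ‖g y‖₊ := by
      intro f y
      simp only [part, ContinuousMap.coe_mk, nnnorm_mul]
      congr 1
      ext
      rw [coe_nnnorm, RCLike.norm_ofReal, abs_of_nonneg (NNReal.coe_nonneg _)]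
    have hle : ∀ f y, ‖part f y‖₊ ≤ f.1 y := by
      intro f y
      rw [hpart, div_mul_eq_mul_div, div_le_iff₀ (pos_iff_ne_zero.2 (hpos y))]
      gcongr
      exact (hg y).trans le_self_add
    have hsum : g = part ⟨f₁, h₁⟩ + part ⟨f₂, h₂⟩ + part ⟨fun _ => δ, continuous_const⟩ := by
      ext y
      simp only [part, ContinuousMap.add_apply, ContinuousMap.coe_mk, ← add_mul,
        ← RCLike.ofReal_add, ← NNReal.coe_add]
      rw [← add_div, ← add_div, div_self (hpos y)]
      simp
    rw [hsum, map_add, map_add]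
    refine (nnnorm_add_le _ _).trans (add_le_add ((nnnorm_add_le _ _).trans (add_le_add
      (le_variation Λ h₁ (hle _)) (le_variation Λ h₂ (hle _)))) ?_)
    exact (nnnorm_apply_le_of_bound Λ (hle ⟨fun _ => δ, continuous_const⟩)).trans hδε
  · have key : ∀ g₁ g₂ : C(K, 𝕜), (∀ y, ‖g₁ y‖₊ ≤ f₁ y) → (∀ y, ‖g₂ y‖₊ ≤ f₂ y) →
        ‖Λ g₁‖₊ + ‖Λ g₂‖₊ ≤ variation Λ (f₁ + f₂) := by
      intro g₁ g₂ hg₁ hg₂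
      obtain ⟨c₁, hc₁, e₁⟩ := RCLike.exists_norm_eq_mul_self (Λ g₁)
      obtain ⟨c₂, hc₂, e₂⟩ := RCLike.exists_norm_eq_mul_self (Λ g₂)
      have h3 : Λ (c₁ • g₁ + c₂ • g₂) = ((‖Λ g₁‖ + ‖Λ g₂‖ : ℝ) : 𝕜) := by
        rw [map_add, map_smul, map_smul, smul_eq_mul, smul_eq_mul, ← e₁, ← e₂, RCLike.ofReal_add]
      have h4 : ‖Λ g₁‖₊ + ‖Λ g₂‖₊ = ‖Λ (c₁ • g₁ + c₂ • g₂)‖₊ := by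
        rw [h3]
        ext
        rw [coe_nnnorm, RCLike.norm_ofReal, abs_of_nonneg (by positivity)]
        rfl
      rw [h4]
      refine le_variation Λ (h₁.add h₂) fun y => ?_
      refine (nnnorm_add_le _ _).trans (add_le_add ?_ ?_)
      · refine le_trans (le_of_eq ?_) (hg₁ y)
        ext; simp [hc₁]
      · refine le_trans (le_of_eq ?_) (hg₂ y)
        ext; simp [hc₂]
    rw [← le_tsub_iff_right ?_]
    · refine variation_le fun g₁ hg₁ => ?_
      rw [le_tsub_iff_left ?_]
      · rw [← le_tsub_iff_right ?_]
        · refine variation_le fun g₂ hg₂ => ?_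
          rw [le_tsub_iff_right ?_]
          · rw [add_comm]; exact key g₁ g₂ hg₁ hg₂
          · exact le_trans (by simp) (key g₁ 0 hg₁ (by simp))
        · exact le_trans (by simp) (key g₁ 0 hg₁ (by simp))
      · exact variation_le fun g₂ hg₂ => le_trans (by simp) (key 0 g₂ (by simp) hg₂)
    · exact variation_le fun g₂ hg₂ => le_trans (by simp) (key 0 g₂ (by simp) hg₂)

/-- For `c ≠ 0` one inequality suffices, since applying it to `c⁻¹` gives the other. -/
lemma variation_smul (Λ : StrongDual 𝕜 C(K, 𝕜)) (c : ℝ≥0) {f : K → ℝ≥0} (hf : Continuous f) :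
    variation Λ (c • f) = c * variation Λ f := by
  have key : ∀ (c : ℝ≥0) (f : K → ℝ≥0), c ≠ 0 → Continuous f →
      variation Λ (c • f) ≤ c * variation Λ f := by
    intro c f hc hf
    refine variation_le fun g hg => ?_
    have h1 : ∀ y, ‖((((c⁻¹ : ℝ≥0) : ℝ) : 𝕜) • g) y‖₊ ≤ f y := by
      intro y
      have h2 : ‖((((c⁻¹ : ℝ≥0) : ℝ) : 𝕜) • g) y‖₊ = c⁻¹ * ‖g y‖₊ := by
        ext; simp
      rw [h2, inv_mul_le_iff₀ (pos_iff_ne_zero.2 hc)]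
      exact hg y
    have h3 := le_variation Λ hf h1
    rw [map_smul, nnnorm_smul] at h3
    have h4 : ‖(((c⁻¹ : ℝ≥0) : ℝ) : 𝕜)‖₊ = c⁻¹ := by ext; simp
    rwa [h4, inv_mul_le_iff₀ (pos_iff_ne_zero.2 hc)] at h3
  rcases eq_or_ne c 0 with rfl | hc
  · rw [zero_smul, zero_mul, ← nonpos_iff_eq_zero]
    refine variation_le fun g hg => ?_
    have : g = 0 := by
      ext y
      simpa using hg y
    simp [this]
  · refine le_antisymm (key c f hc hf) ?_
    have h1 := key c⁻¹ (c • f) (inv_ne_zero hc) (hf.const_smul c)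
    rwa [smul_smul, inv_mul_cancel₀ hc, one_smul, le_inv_mul_iff₀ (pos_iff_ne_zero.2 hc)] at h1

/-- The total variation as a positive functional. -/
def variationFunctional (Λ : StrongDual 𝕜 C(K, 𝕜)) :
    CompactlySupportedContinuousMap K ℝ≥0 →ₗ[ℝ≥0] ℝ≥0 where
  toFun f := variation Λ f
  map_add' f g := variation_add Λ f.continuous g.continuous
  map_smul' c f := variation_smul Λ c f.continuous

variable [T2Space K] [MeasurableSpace K] [BorelSpace K]

/-- The total variation measure of a functional on `C(K)`. -/
def variationMeasure (Λ : StrongDual 𝕜 C(K, 𝕜)) : Measure K :=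
  NNRealRMK.rieszMeasure (variationFunctional Λ)

instance (Λ : StrongDual 𝕜 C(K, 𝕜)) : (variationMeasure Λ).Regular := by
  unfold variationMeasure; infer_instance

lemma lintegral_variationMeasure (Λ : StrongDual 𝕜 C(K, 𝕜)) {f : K → ℝ≥0} (hf : Continuous f) :
    ∫⁻ y, f y ∂(variationMeasure Λ) = variation Λ f :=
  NNRealRMK.lintegral_rieszMeasure (variationFunctional Λ)
    ⟨⟨f, hf⟩, HasCompactSupport.of_compactSpace f⟩

lemma variationMeasure_univ_le (Λ : StrongDual 𝕜 C(K, 𝕜)) :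
    variationMeasure Λ Set.univ ≤ ‖Λ‖ₑ := by
  have h1 := lintegral_variationMeasure Λ (f := fun _ => 1) continuous_const
  simp only [ENNReal.coe_one, lintegral_const, one_mul] at h1
  rw [h1]
  refine ENNReal.coe_le_coe.2 (variation_le fun g hg => ?_)
  simpa using nnnorm_apply_le_of_bound Λ hg

instance (Λ : StrongDual 𝕜 C(K, 𝕜)) : IsFiniteMeasure (variationMeasure Λ) :=
  ⟨(variationMeasure_univ_le Λ).trans_lt enorm_lt_top⟩

lemma enorm_apply_le_lintegral (Λ : StrongDual 𝕜 C(K, 𝕜)) (g : C(K, 𝕜)) :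
    ‖Λ g‖ₑ ≤ ∫⁻ y, ‖g y‖ₑ ∂(variationMeasure Λ) := by
  have h1 := lintegral_variationMeasure Λ (f := fun y => ‖g y‖₊) (by fun_prop)
  exact le_trans (ENNReal.coe_le_coe.2 (le_variation Λ (by fun_prop) fun y => le_rfl)) h1.ge

/-- As `|Λ g| ≤ ∫ |g| d|Λ|`, the functional descends to the image of `C(K)` in `L₁(|Λ|)`, and
Hahn-Banach extends it. This gives `Λ` a value on indicators. -/
lemma exists_L1_extension (Λ : StrongDual 𝕜 C(K, 𝕜)) :
    ∃ Φ : Lp 𝕜 1 (variationMeasure Λ) →L[𝕜] 𝕜, ‖Φ‖ ≤ 1 ∧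
      ∀ g : C(K, 𝕜), Φ (ContinuousMap.toLp 1 (variationMeasure Λ) 𝕜 g) = Λ g := by
  obtain ⟨Φ, h1, h2⟩ := exists_extension_along (normSeminorm 𝕜 (Lp 𝕜 1 (variationMeasure Λ)))
    (ContinuousMap.toLp 1 (variationMeasure Λ) 𝕜 : C(K, 𝕜) →L[𝕜] _).toLinearMap Λ.toLinearMap
    (fun g => by
      rw [coe_normSeminorm]
      refine enorm_le_iff_norm_le.1 ((enorm_apply_le_lintegral Λ g).trans (le_of_eq ?_))
      change _ = ‖ContinuousMap.toLp 1 (variationMeasure Λ) 𝕜 g‖ₑ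
      rw [Lp.enorm_def, eLpNorm_one_eq_lintegral_enorm]
      refine lintegral_congr_ae ?_
      filter_upwards [ContinuousMap.coeFn_toLp (p := 1) (𝕜 := 𝕜) (variationMeasure Λ) g]
        with y hy
      rw [hy])
  exact ⟨Φ.mkContinuous 1 (fun v => by simpa using h2 v),
    LinearMap.mkContinuous_norm_le _ zero_le_one _, h1⟩

/-- A norm one extension of `Λ` from `C(K)` to `L₁(|Λ|)`. -/
def extL1 (Λ : StrongDual 𝕜 C(K, 𝕜)) : Lp 𝕜 1 (variationMeasure Λ) →L[𝕜] 𝕜 :=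
  (exists_L1_extension Λ).choose

lemma enorm_extL1_le (Λ : StrongDual 𝕜 C(K, 𝕜)) : ‖extL1 Λ‖ₑ ≤ 1 := by
  rw [← ofReal_norm]
  exact ENNReal.ofReal_le_one.2 (exists_L1_extension Λ).choose_spec.1

lemma extL1_toLp (Λ : StrongDual 𝕜 C(K, 𝕜)) (g : C(K, 𝕜)) :
    extL1 Λ (ContinuousMap.toLp 1 (variationMeasure Λ) 𝕜 g) = Λ g :=
  (exists_L1_extension Λ).choose_spec.2 g

/-- The value on `F` of the measure representing the functional `Λ`. -/
def reprMeasure {F : Set K} (hF : MeasurableSet F) (Λ : StrongDual 𝕜 C(K, 𝕜)) : 𝕜 :=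
  extL1 Λ (indicatorConstLp 1 hF (measure_ne_top _ F) 1)

lemma enorm_reprMeasure_le {F : Set K} (hF : MeasurableSet F) (Λ : StrongDual 𝕜 C(K, 𝕜)) :
    ‖reprMeasure hF Λ‖ₑ ≤ variationMeasure Λ F := by
  refine ((extL1 Λ).le_opENorm _).trans ?_
  refine (mul_le_of_le_one_left' (enorm_extL1_le Λ)).trans ?_
  rw [Lp.enorm_def, eLpNorm_congr_ae indicatorConstLp_coeFn,
    eLpNorm_indicator_const hF one_ne_zero ENNReal.one_ne_top]
  simp

lemma enorm_reprMeasure_sub_le {F : Set K} (hF : MeasurableSet F) (Λ : StrongDual 𝕜 C(K, 𝕜))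
    (g : C(K, 𝕜)) : ‖reprMeasure hF Λ - Λ g‖ₑ ≤
      ∫⁻ y, ‖F.indicator (fun _ => (1 : 𝕜)) y - g y‖ₑ ∂(variationMeasure Λ) := by
  rw [← extL1_toLp, reprMeasure, ← map_sub]
  refine ((extL1 Λ).le_opENorm _).trans ?_
  refine (mul_le_of_le_one_left' (enorm_extL1_le Λ)).trans (le_of_eq ?_)
  rw [Lp.enorm_def, eLpNorm_one_eq_lintegral_enorm]
  refine lintegral_congr_ae ?_
  filter_upwards [Lp.coeFn_sub (indicatorConstLp 1 hF (measure_ne_top (variationMeasure Λ) F)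
      (1 : 𝕜)) (ContinuousMap.toLp 1 (variationMeasure Λ) 𝕜 g),
    indicatorConstLp_coeFn (p := 1) (hs := hF) (hμs := measure_ne_top (variationMeasure Λ) F)
      (c := (1 : 𝕜)),
    ContinuousMap.coeFn_toLp (p := 1) (𝕜 := 𝕜) (variationMeasure Λ) g] with y h1 h2 h3
  rw [h1, Pi.sub_apply, h2, h3]

lemma exists_continuous_approx {F : Set K} (hF : MeasurableSet F) (μ : Measure K)
    [IsFiniteMeasure μ] [μ.WeaklyRegular] {ε : ℝ≥0∞} (hε : ε ≠ 0) :
    ∃ g : C(K, 𝕜), ∫⁻ y, ‖F.indicator (fun _ => (1 : 𝕜)) y - g y‖ₑ ∂μ ≤ ε := by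
  have hm : MemLp (F.indicator fun _ => (1 : 𝕜)) 1 μ :=
    (memLp_const (1 : 𝕜)).indicator hF
  obtain ⟨g, hg, -⟩ := hm.exists_boundedContinuous_eLpNorm_sub_le ENNReal.one_ne_top hε
  refine ⟨g.toContinuousMap, ?_⟩
  rw [eLpNorm_one_eq_lintegral_enorm] at hg
  exact hg

/-- The extension to `L₁(|Λ|)` is chosen for each `Λ` separately, so linearity in `Λ` needs an
argument: one continuous `g` close to `1_F` for all three variation measures reduces it to the
linearity of `Λ ↦ Λ g`. -/
lemma reprMeasure_combination {F : Set K} (hF : MeasurableSet F) (c : 𝕜)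
    (Λ₁ Λ₂ : StrongDual 𝕜 C(K, 𝕜)) :
    reprMeasure hF (c • Λ₁ + Λ₂) = c * reprMeasure hF Λ₁ + reprMeasure hF Λ₂ := by
  set Λ₃ := c • Λ₁ + Λ₂ with h₃
  let μ := variationMeasure Λ₁ + variationMeasure Λ₂ + variationMeasure Λ₃
  have : μ.WeaklyRegular := inferInstance
  have key : ∀ ε : ℝ, 0 < ε → ‖reprMeasure hF Λ₃ - (c * reprMeasure hF Λ₁ + reprMeasure hF Λ₂)‖ ≤
      ε * (2 + ‖c‖) := by
    intro ε hε
    obtain ⟨g, hg⟩ := exists_continuous_approx (𝕜 := 𝕜) hF μ (ENNReal.ofReal_pos.2 hε).ne'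
    have hle : ∀ Λ : StrongDual 𝕜 C(K, 𝕜), variationMeasure Λ ≤ μ →
        ‖reprMeasure hF Λ - Λ g‖ ≤ ε := by
      intro Λ hΛ
      have h1 := (enorm_reprMeasure_sub_le hF Λ g).trans ((lintegral_mono' hΛ le_rfl).trans hg)
      rw [← ofReal_norm] at h1
      exact (ENNReal.ofReal_le_ofReal_iff hε.le).1 h1
    have e1 := hle Λ₁ (Measure.le_add_right (Measure.le_add_right le_rfl))
    have e2 := hle Λ₂ (Measure.le_add_right (Measure.le_add_left le_rfl))
    have e3 := hle Λ₃ (Measure.le_add_left le_rfl)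
    have e4 : reprMeasure hF Λ₃ - (c * reprMeasure hF Λ₁ + reprMeasure hF Λ₂) =
        (reprMeasure hF Λ₃ - Λ₃ g) - (c * (reprMeasure hF Λ₁ - Λ₁ g) +
          (reprMeasure hF Λ₂ - Λ₂ g)) := by
      rw [h₃]; simp; ring
    rw [e4]
    refine (norm_sub_le _ _).trans ?_
    have e5 := norm_add_le (c * (reprMeasure hF Λ₁ - Λ₁ g)) (reprMeasure hF Λ₂ - Λ₂ g)
    rw [norm_mul] at e5
    nlinarith [mul_le_mul_of_nonneg_left e1 (norm_nonneg c)]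
  refine sub_eq_zero.1 (norm_le_zero_iff.1 (le_of_forall_pos_le_add fun ε hε => ?_))
  have hc : 0 < 2 + ‖c‖ := by positivity
  have := key (ε / (2 + ‖c‖)) (by positivity)
  rw [div_mul_cancel₀ _ hc.ne'] at this
  linarith

end Variation

/-! ### Factoring the barycentre map through `ℓ₁`, given a decomposition of the ball -/

section Atoms

variable {𝕜 : Type*} [RCLike 𝕜]

/-- A decomposition `y = ∑ᵢ wᵢ 1_{Fᵢ}(y) zᵢ` of the points of the ball of `ℓ₂`, with bounded
vectors `zᵢ` and `∑ᵢ wᵢ 1_{Fᵢ} ≤ 2`. -/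
structure BallAtoms (𝕜 : Type*) [RCLike 𝕜] (ι : Type*) where
  /-- the supports -/
  F : ι → Set (ballSet 𝕜)
  /-- the weights -/
  w : ι → ℝ≥0
  /-- the vectors -/
  z : ι → Ell2 𝕜
  measurableSet : ∀ i, MeasurableSet (F i)
  norm_le : ∀ i, ‖z i‖ ≤ 3
  tsum_le : ∀ y, ∑' i, (F i).indicator (fun _ => (w i : ℝ≥0∞)) y ≤ 2
  hasSum : ∀ y j, HasSum (fun i => (F i).indicator (fun _ => ((w i : ℝ) : 𝕜) * z i j) y) (y.1 j)

namespace BallAtoms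

variable {ι : Type u} (D : BallAtoms 𝕜 ι)

/-- The coefficients of a functional with respect to the atoms. -/
def coeff (Λ : StrongDual 𝕜 C(ballSet 𝕜, 𝕜)) (i : ι) : 𝕜 :=
  ((D.w i : ℝ) : 𝕜) * reprMeasure (D.measurableSet i) Λ

lemma enorm_ofReal_nnreal (w : ℝ≥0) : ‖((w : ℝ) : 𝕜)‖ₑ = w := by
  rw [← ofReal_norm, RCLike.norm_ofReal, abs_of_nonneg w.coe_nonneg, ENNReal.ofReal_coe_nnreal]

lemma tsum_weights_le [Countable ι] (μ : Measure (ballSet 𝕜)) :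
    ∑' i, (D.w i : ℝ≥0∞) * μ (D.F i) ≤ 2 * μ Set.univ := by
  calc ∑' i, (D.w i : ℝ≥0∞) * μ (D.F i)
      = ∑' i, ∫⁻ y, (D.F i).indicator (fun _ => (D.w i : ℝ≥0∞)) y ∂μ := by
        congr 1
        funext i
        rw [lintegral_indicator_const (D.measurableSet i)]
    _ = ∫⁻ y, ∑' i, (D.F i).indicator (fun _ => (D.w i : ℝ≥0∞)) y ∂μ := by
        rw [lintegral_tsum]
        exact fun i => (measurable_const.indicator (D.measurableSet i)).aemeasurable
    _ ≤ ∫⁻ _, 2 ∂μ := lintegral_mono fun y => D.tsum_le y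
    _ = _ := by simp

lemma tsum_enorm_coeff_le [Countable ι] (Λ : StrongDual 𝕜 C(ballSet 𝕜, 𝕜)) :
    ∑' i, ‖D.coeff Λ i‖ₑ ≤ 2 * ‖Λ‖ₑ := by
  refine le_trans (ENNReal.tsum_le_tsum fun i => ?_) ((D.tsum_weights_le (variationMeasure Λ)).trans
    (mul_le_mul_right (variationMeasure_univ_le Λ) _))
  rw [coeff, enorm_mul, enorm_ofReal_nnreal]
  exact mul_le_mul_right (enorm_reprMeasure_le _ Λ) _

/-- The pointwise expansion of the `j`-th coordinate converges absolutely in `L₁(|Λ|)`, by the bound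
on the weights, so the continuous functional `extL1 Λ` may be applied term by term. -/
lemma apply_coordFun_eq_tsum [Countable ι] (Λ : StrongDual 𝕜 C(ballSet 𝕜, 𝕜)) (j : ℕ) :
    Λ (coordFun j) = ∑' i, D.coeff Λ i * D.z i j := by
  set μ := variationMeasure Λ
  let a : ι → Lp 𝕜 1 μ := fun i => indicatorConstLp 1 (D.measurableSet i)
    (measure_ne_top μ (D.F i)) (((D.w i : ℝ) : 𝕜) * D.z i j)
  have hz : ∀ i, ‖D.z i j‖ₑ ≤ 3 := by
    intro i
    have h : ‖D.z i j‖ ≤ 3 := (lp.norm_apply_le_norm two_ne_zero (D.z i) j).trans (D.norm_le i)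
    rw [← ofReal_norm]
    exact (ENNReal.ofReal_le_ofReal h).trans (by simp)
  have ha : ∑' i, ‖a i‖ₑ ≠ ∞ := by
    refine ne_top_of_le_ne_top (b := ∑' i, ((D.w i : ℝ≥0∞) * μ (D.F i)) * 3) ?_ ?_
    · rw [ENNReal.tsum_mul_right]
      exact ENNReal.mul_ne_top (ne_top_of_le_ne_top (ENNReal.mul_ne_top (by simp)
        (measure_ne_top μ _)) (D.tsum_weights_le μ)) (by simp)
    · refine ENNReal.tsum_le_tsum fun i => ?_
      rw [Lp.enorm_def, eLpNorm_congr_ae indicatorConstLp_coeFn,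
        eLpNorm_indicator_const (D.measurableSet i) one_ne_zero ENNReal.one_ne_top, enorm_mul,
        enorm_ofReal_nnreal]
      simp only [ENNReal.toReal_one, div_one, ENNReal.rpow_one]
      rw [mul_right_comm]
      exact mul_le_mul_right (hz i) _
  have hsum : HasSum a (∑' i, a i) := (ENNReal.tsum_coe_ne_top_iff_summable.1 ha).of_nnnorm.hasSum
  have heq : ∑' i, a i = ContinuousMap.toLp 1 μ 𝕜 (coordFun j) := by
    refine Lp.ext ?_
    have h3 : ∀ᵐ y ∂μ, ∀ i, a i y =
        (D.F i).indicator (fun _ => ((D.w i : ℝ) : 𝕜) * D.z i j) y :=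
      ae_all_iff.2 fun i => indicatorConstLp_coeFn
    filter_upwards [Lp.hasSum_coeFn_tsum ha, h3,
      ContinuousMap.coeFn_toLp (p := 1) (𝕜 := 𝕜) μ (coordFun j)] with y h1 h2 h4
    rw [h4]
    simp only [h2] at h1
    exact h1.unique (D.hasSum y j)
  have h5 := hsum.mapL (extL1 Λ)
  rw [heq, extL1_toLp] at h5
  rw [← h5.tsum_eq]
  refine tsum_congr fun i => ?_
  have h6 : a i = (((D.w i : ℝ) : 𝕜) * D.z i j) •
      indicatorConstLp 1 (D.measurableSet i) (measure_ne_top μ (D.F i)) (1 : 𝕜) := by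
    refine Lp.ext ?_
    filter_upwards [indicatorConstLp_coeFn (p := 1) (hs := D.measurableSet i)
        (hμs := measure_ne_top μ (D.F i)) (c := ((D.w i : ℝ) : 𝕜) * D.z i j),
      indicatorConstLp_coeFn (p := 1) (hs := D.measurableSet i)
        (hμs := measure_ne_top μ (D.F i)) (c := (1 : 𝕜)),
      Lp.coeFn_smul (((D.w i : ℝ) : 𝕜) * D.z i j) (indicatorConstLp 1 (D.measurableSet i)
        (measure_ne_top μ (D.F i)) (1 : 𝕜))] with y h1 h2 h3
    rw [h1, h3, Pi.smul_apply, h2]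
    by_cases hy : y ∈ D.F i <;> simp [hy]
  rw [h6, map_smul, smul_eq_mul, coeff, mul_right_comm]
  rfl

variable [Countable ι] [MeasurableSpace ι] [DiscreteMeasurableSpace ι]

lemma eLpNorm_coeff_le (Λ : StrongDual 𝕜 C(ballSet 𝕜, 𝕜)) :
    eLpNorm (D.coeff Λ) 1 (Measure.count : Measure ι) ≤ 2 * ‖Λ‖ₑ := by
  rw [eLpNorm_one_eq_lintegral_enorm, lintegral_count]
  exact D.tsum_enorm_coeff_le Λ

lemma memLp_coeff (Λ : StrongDual 𝕜 C(ballSet 𝕜, 𝕜)) :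
    MemLp (D.coeff Λ) 1 (Measure.count : Measure ι) :=
  ⟨(measurable_of_countable _).aestronglyMeasurable,
    (D.eLpNorm_coeff_le Λ).trans_lt (ENNReal.mul_lt_top (by simp) enorm_lt_top)⟩

/-- The coefficients as an operator into `ℓ₁`. -/
def coeffOp : StrongDual 𝕜 C(ballSet 𝕜, 𝕜) →L[𝕜] Lp 𝕜 1 (Measure.count : Measure ι) :=
  LinearMap.mkContinuous
    (IsLinearMap.mk' (fun Λ => (D.memLp_coeff Λ).toLp (D.coeff Λ))
      ⟨fun Λ₁ Λ₂ => by
        rw [← MemLp.toLp_add]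
        congr 1
        funext i
        have := reprMeasure_combination (D.measurableSet i) 1 Λ₁ Λ₂
        simp only [one_smul, one_mul] at this
        simp [coeff, this, mul_add],
      fun c Λ => by
        rw [← MemLp.toLp_const_smul]
        congr 1
        funext i
        have h0 := reprMeasure_combination (D.measurableSet i) 1 (0 : StrongDual 𝕜 C(ballSet 𝕜, 𝕜)) 0
        have := reprMeasure_combination (D.measurableSet i) c Λ 0
        have h1 : reprMeasure (D.measurableSet i) (0 : StrongDual 𝕜 C(ballSet 𝕜, 𝕜)) = 0 := by
          simpa using h0
        rw [add_zero, h1, add_zero] at this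
        simp [coeff, this, mul_left_comm]⟩) 2 fun Λ => by
    change ‖(D.memLp_coeff Λ).toLp (D.coeff Λ)‖ ≤ _
    have h := D.eLpNorm_coeff_le Λ
    rw [Lp.norm_toLp]
    refine ENNReal.toReal_le_of_le_ofReal (by positivity) (h.trans (le_of_eq ?_))
    rw [ENNReal.ofReal_mul zero_le_two, ofReal_norm]
    simp

lemma enorm_coeffOp_le : ‖D.coeffOp‖ₑ ≤ 2 := by
  have h : ‖D.coeffOp‖ ≤ 2 := LinearMap.mkContinuous_norm_le _ zero_le_two _
  rw [← ofReal_norm]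
  exact (ENNReal.ofReal_le_ofReal h).trans (by simp)

lemma integrable_smul (f : Lp 𝕜 1 (Measure.count : Measure ι)) :
    Integrable (fun i => f i • D.z i) Measure.count :=
  (L1.integrable_coeFn f).smul_bdd (C := 3)
    StronglyMeasurable.of_discrete.aestronglyMeasurable (ae_of_all _ D.norm_le)

/-- The operator `ℓ₁ → ℓ₂` that sends the unit vectors to the atoms. -/
def sumOp : Lp 𝕜 1 (Measure.count : Measure ι) →L[𝕜] Ell2 𝕜 :=
  LinearMap.mkContinuous
    (IsLinearMap.mk' (fun f => ∫ i, f i • D.z i ∂Measure.count)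
      ⟨fun f g => by
        rw [← integral_add (D.integrable_smul f) (D.integrable_smul g)]
        refine integral_congr_ae ?_
        filter_upwards [Lp.coeFn_add f g] with i hi
        rw [hi, Pi.add_apply, add_smul],
      fun c f => by
        rw [← integral_smul]
        refine integral_congr_ae ?_
        filter_upwards [Lp.coeFn_smul c f] with i hi
        rw [hi, Pi.smul_apply, smul_assoc]⟩) 3 fun f => by
    change ‖∫ i, f i • D.z i ∂Measure.count‖ ≤ _
    rw [L1.norm_eq_integral_norm, ← integral_const_mul]
    refine norm_integral_le_of_norm_le ((L1.integrable_coeFn f).norm.const_mul 3)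
      (ae_of_all _ fun i => ?_)
    rw [norm_smul, mul_comm]
    exact mul_le_mul_of_nonneg_right (D.norm_le i) (norm_nonneg _)

lemma enorm_sumOp_le : ‖D.sumOp‖ₑ ≤ 3 := by
  have h : ‖D.sumOp‖ ≤ 3 := LinearMap.mkContinuous_norm_le _ (by norm_num) _
  rw [← ofReal_norm]
  exact (ENNReal.ofReal_le_ofReal h).trans (by simp)

lemma sumOp_apply (f : Lp 𝕜 1 (Measure.count : Measure ι)) (j : ℕ) :
    D.sumOp f j = ∑' i, f i * D.z i j := by
  have h1 : D.sumOp f j = ∫ i, f i * D.z i j ∂Measure.count :=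
    (((lp.evalCLM 𝕜 (fun _ : ℕ => 𝕜) 2 j).integral_comp_comm (D.integrable_smul f))).symm
  have h2 : Integrable (fun i => f i * D.z i j) Measure.count :=
    (lp.evalCLM 𝕜 (fun _ : ℕ => 𝕜) 2 j).integrable_comp (D.integrable_smul f)
  rw [h1, integral_countable h2]
  simp [Measure.real]

lemma sumOp_coeffOp (Λ : StrongDual 𝕜 C(ballSet 𝕜, 𝕜)) (j : ℕ) :
    D.sumOp (D.coeffOp Λ) j = Λ (coordFun j) := by
  rw [sumOp_apply, apply_coordFun_eq_tsum D]
  have h : ∀ᵐ i ∂(Measure.count : Measure ι), D.coeffOp Λ i = D.coeff Λ i :=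
    MemLp.coeFn_toLp (D.memLp_coeff Λ)
  refine tsum_congr fun i => ?_
  rw [Measure.ae_count_iff.1 h i]

end BallAtoms

end Atoms

/-! ### Constructing the decomposition by successive approximation -/

section Existence

variable (𝕜 : Type*) [RCLike 𝕜]

instance : TopologicalSpace.SeparableSpace (Ell2 𝕜) := by
  have h1 : TopologicalSpace.IsSeparable
      (Submodule.span 𝕜 (Set.range (unitVec 𝕜)) : Set (Ell2 𝕜)) :=
    (Set.countable_range _).isSeparable.span
  have h2 : closure (Submodule.span 𝕜 (Set.range (unitVec 𝕜)) : Set (Ell2 𝕜)) = Set.univ := by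
    refine Set.eq_univ_of_forall fun f => ?_
    have h3 := (lp.hasSum_single (p := 2) (by simp) f).tendsto_sum_nat
    refine mem_closure_of_tendsto h3 (Eventually.of_forall fun n => ?_)
    refine Submodule.sum_mem _ fun i _ => ?_
    have h4 : lp.single 2 i (f i) = f i • unitVec 𝕜 i := by
      rw [unitVec, ← lp.single_smul, smul_eq_mul, mul_one]
    rw [h4]
    exact Submodule.smul_mem _ _ (Submodule.subset_span ⟨i, rfl⟩)
  have h5 := h1.closure
  rw [h2] at h5
  exact TopologicalSpace.isSeparable_univ_iff.1 h5

/-- A dense sequence in `ℓ₂` that starts with `0`. -/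
def denseSeq₀ : ℕ → Ell2 𝕜
  | 0 => 0
  | k + 1 => TopologicalSpace.denseSeq (Ell2 𝕜) k

variable {𝕜}

/-- A point of the ball as a vector of `ℓ₂`. -/
def toVec (y : ballSet 𝕜) : Ell2 𝕜 :=
  ⟨y.1, memℓp_gen (by
    simpa using summable_of_sum_range_le (fun j => sq_nonneg ‖y.1 j‖) y.2)⟩

lemma norm_le_iff_sum_le (v : Ell2 𝕜) {r : ℝ} (hr : 0 ≤ r) :
    ‖v‖ ≤ r ↔ ∀ N, ∑ j ∈ Finset.range N, ‖v j‖ ^ 2 ≤ r ^ 2 := by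
  have h2 : HasSum (fun j => ‖v j‖ ^ 2) (‖v‖ ^ 2) := by
    simpa using lp.hasSum_norm (p := 2) (by norm_num) v
  rw [← sq_le_sq₀ (norm_nonneg _) hr]
  exact ⟨fun h N => (sum_le_hasSum _ (fun _ _ => sq_nonneg _) h2).trans h,
    fun h => le_of_tendsto' h2.tendsto_sum_nat h⟩

lemma norm_toVec_le (y : ballSet 𝕜) : ‖toVec y‖ ≤ 1 :=
  (norm_le_iff_sum_le _ zero_le_one).2 fun N => by rw [one_pow]; exact y.2 N

/-- The norm is not continuous for the product topology, but it is a supremum of continuous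
functions, so its sublevel sets are closed. -/
lemma measurableSet_norm_toVec_sub_le (z : Ell2 𝕜) {r : ℝ} (hr : 0 ≤ r) :
    MeasurableSet {y : ballSet 𝕜 | ‖toVec y - z‖ ≤ r} := by
  simp only [norm_le_iff_sum_le _ hr]
  rw [Set.ofPred_forall]
  refine (isClosed_iInter fun N => isClosed_le ?_ continuous_const).measurableSet
  refine continuous_finsetSum _ fun j _ => ((Continuous.norm ?_).pow 2)
  exact ((continuous_apply j).comp continuous_subtype_val).sub continuous_const

lemma exists_denseSeq₀_close (v : Ell2 𝕜) {r : ℝ} (hr : 0 < r) :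
    ∃ k, ‖v - denseSeq₀ 𝕜 k‖ ≤ r := by
  obtain ⟨k, hk⟩ := (TopologicalSpace.denseRange_denseSeq (Ell2 𝕜)).exists_dist_lt v hr
  exact ⟨k + 1, by rw [← dist_eq_norm]; exact hk.le⟩

lemma exists_index (m : ℕ) (y : ballSet 𝕜) :
    ∃ k, ‖toVec y - denseSeq₀ 𝕜 k‖ ≤ 2 * (1 / 2 : ℝ) ^ m :=
  exists_denseSeq₀_close _ (by positivity)

open Classical in
/-- The index of the first member of the dense sequence within distance `2 · 2⁻ᵐ` of `y`. -/
def approxIndex (m : ℕ) (y : ballSet 𝕜) : ℕ := Nat.find (exists_index m y)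

open Classical in
lemma norm_sub_approxIndex_le (m : ℕ) (y : ballSet 𝕜) :
    ‖toVec y - denseSeq₀ 𝕜 (approxIndex m y)‖ ≤ 2 * (1 / 2 : ℝ) ^ m :=
  Nat.find_spec (exists_index m y)

-- At scale 0 the radius is 2 and the dense sequence starts with 0, so 0 is always chosen. The
-- telescoping series in `hasSum_atoms` thus has no initial term.
open Classical in
lemma approxIndex_zero (y : ballSet 𝕜) : approxIndex 0 y = 0 := by
  refine (Nat.find_eq_zero _).2 ?_
  rw [denseSeq₀, sub_zero]
  linarith [norm_toVec_le y]

open Classical in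
lemma measurable_approxIndex (m : ℕ) : Measurable (approxIndex (𝕜 := 𝕜) m) :=
  measurable_find _ fun _ => measurableSet_norm_toVec_sub_le _ (by positivity)

/-- The atoms with index `(m, k, l)`. -/
def atomVec (i : ℕ × ℕ × ℕ) : Ell2 𝕜 :=
  if ‖denseSeq₀ 𝕜 i.2.1 - denseSeq₀ 𝕜 i.2.2‖ ≤ 3 * (1 / 2 : ℝ) ^ i.1 then
    (((2 : ℝ) ^ i.1 : ℝ) : 𝕜) • (denseSeq₀ 𝕜 i.2.1 - denseSeq₀ 𝕜 i.2.2) else 0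

/-- The cutoff in `atomVec` secures the bound also for index pairs that no point of the ball
produces. -/
lemma norm_atomVec_le (i : ℕ × ℕ × ℕ) : ‖atomVec (𝕜 := 𝕜) i‖ ≤ 3 := by
  unfold atomVec
  split_ifs with h
  · rw [norm_smul, RCLike.norm_ofReal, abs_of_nonneg (by positivity)]
    calc (2 : ℝ) ^ i.1 * ‖denseSeq₀ 𝕜 i.2.1 - denseSeq₀ 𝕜 i.2.2‖
        ≤ 2 ^ i.1 * (3 * (1 / 2 : ℝ) ^ i.1) := by gcongr
      _ = 3 * (2 * (1 / 2 : ℝ)) ^ i.1 := by rw [mul_pow]; ring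
      _ = 3 := by norm_num
  · simp

/-- For consecutive approximations of one point the cutoff is inactive, because `2 · 2⁻⁽ᵐ⁺¹⁾ + 2 ·
2⁻ᵐ = 3 · 2⁻ᵐ`. -/
lemma smul_atomVec (m : ℕ) (y : ballSet 𝕜) :
    (((1 / 2 : ℝ) ^ m : ℝ) : 𝕜) • atomVec (𝕜 := 𝕜) (m, approxIndex (m + 1) y, approxIndex m y) =
      denseSeq₀ 𝕜 (approxIndex (m + 1) y) - denseSeq₀ 𝕜 (approxIndex m y) := by
  have h : ‖denseSeq₀ 𝕜 (approxIndex (m + 1) y) - denseSeq₀ 𝕜 (approxIndex m y)‖ ≤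
      3 * (1 / 2 : ℝ) ^ m := by
    have h1 := norm_sub_approxIndex_le (m + 1) y
    have h2 := norm_sub_approxIndex_le m y
    have h3 := norm_sub_le (toVec y - denseSeq₀ 𝕜 (approxIndex m y))
      (toVec y - denseSeq₀ 𝕜 (approxIndex (m + 1) y))
    rw [sub_sub_sub_cancel_left] at h3
    rw [pow_succ] at h1
    linarith
  rw [atomVec, if_pos h, smul_smul, ← RCLike.ofReal_mul, ← mul_pow]
  norm_num

/-- The support of the atom with index `(m, k, l)`. -/
def atomSet (i : ℕ × ℕ × ℕ) : Set (ballSet 𝕜) :=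
  {y | approxIndex (i.1 + 1) y = i.2.1 ∧ approxIndex i.1 y = i.2.2}

/-- The indices of the atoms whose support contains `y`. -/
def atomIndex (y : ballSet 𝕜) (m : ℕ) : ULift.{u} (ℕ × ℕ × ℕ) :=
  ⟨(m, approxIndex (m + 1) y, approxIndex m y)⟩

lemma atomIndex_injective (y : ballSet 𝕜) : Function.Injective (atomIndex.{u} y) := by
  intro m n h
  exact congrArg (fun i => i.down.1) h

lemma mem_atomSet_atomIndex (y : ballSet 𝕜) (m : ℕ) : y ∈ atomSet (atomIndex.{u} y m).down :=
  ⟨rfl, rfl⟩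

lemma notMem_atomSet {y : ballSet 𝕜} {i : ULift.{u} (ℕ × ℕ × ℕ)}
    (h : i ∉ Set.range (atomIndex y)) : y ∉ atomSet i.down := by
  rintro ⟨h1, h2⟩
  refine h ⟨i.down.1, ?_⟩
  rw [atomIndex, h1, h2]

lemma tendsto_denseSeq₀_approxIndex (y : ballSet 𝕜) (j : ℕ) :
    Tendsto (fun m => denseSeq₀ 𝕜 (approxIndex m y) j) atTop (𝓝 (y.1 j)) := by
  have h1 : Tendsto (fun m : ℕ => 2 * (1 / 2 : ℝ) ^ m) atTop (𝓝 0) := by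
    simpa using (tendsto_pow_atTop_nhds_zero_of_lt_one (r := (1 / 2 : ℝ)) (by norm_num)
      (by norm_num)).const_mul 2
  rw [tendsto_iff_norm_sub_tendsto_zero]
  refine squeeze_zero (fun _ => norm_nonneg _) (fun m => ?_) h1
  refine le_trans ?_ (norm_sub_approxIndex_le m y)
  rw [norm_sub_rev]
  exact lp.norm_apply_le_norm two_ne_zero (toVec y - denseSeq₀ 𝕜 (approxIndex m y)) j

lemma hasSum_atoms (y : ballSet 𝕜) (j : ℕ) :
    HasSum (fun m => (((1 / 2 : ℝ) ^ m : ℝ) : 𝕜) *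
      atomVec (𝕜 := 𝕜) (m, approxIndex (m + 1) y, approxIndex m y) j) (y.1 j) := by
  have hs : Summable (fun m => (((1 / 2 : ℝ) ^ m : ℝ) : 𝕜) *
      atomVec (𝕜 := 𝕜) (m, approxIndex (m + 1) y, approxIndex m y) j) := by
    refine Summable.of_norm_bounded (summable_geometric_two.mul_right 3) fun m => ?_
    rw [norm_mul, RCLike.norm_ofReal, abs_of_nonneg (by positivity)]
    gcongr
    exact (lp.norm_apply_le_norm two_ne_zero _ j).trans (norm_atomVec_le _)
  rw [hs.hasSum_iff_tendsto_nat]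
  refine (tendsto_denseSeq₀_approxIndex y j).congr fun n => ?_
  have h1 : ∀ m, (((1 / 2 : ℝ) ^ m : ℝ) : 𝕜) *
      atomVec (𝕜 := 𝕜) (m, approxIndex (m + 1) y, approxIndex m y) j =
      denseSeq₀ 𝕜 (approxIndex (m + 1) y) j - denseSeq₀ 𝕜 (approxIndex m y) j := by
    intro m
    have := congrArg (fun v : Ell2 𝕜 => v j) (smul_atomVec m y)
    simpa using this
  rw [Finset.sum_congr rfl fun m _ => h1 m,
    Finset.sum_range_sub (fun m => denseSeq₀ 𝕜 (approxIndex m y) j), approxIndex_zero]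
  simp [denseSeq₀]

variable (𝕜) in
/-- The atoms given by the differences of consecutive approximations from a dense sequence. -/
def ballAtoms : BallAtoms 𝕜 (ULift.{u} (ℕ × ℕ × ℕ)) where
  F i := atomSet i.down
  w i := (1 / 2) ^ i.down.1
  z i := atomVec i.down
  measurableSet i :=
    ((measurable_approxIndex _) (measurableSet_singleton _)).inter
      ((measurable_approxIndex _) (measurableSet_singleton _))
  norm_le i := norm_atomVec_le _
  tsum_le y := by
    -- Each `y` lies in exactly one set per level `m`, so the sum over all indices reduces to `∑ 2⁻ᵐ
    -- = 2`.
    rw [← (atomIndex_injective y).tsum_eq]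
    · refine le_of_eq ((tsum_congr fun m =>
        Set.indicator_of_mem (mem_atomSet_atomIndex.{u} y m) _).trans ?_)
      have h := ENNReal.tsum_geometric 2⁻¹
      rw [ENNReal.one_sub_inv_two, inv_inv] at h
      refine Eq.trans (tsum_congr fun m => ?_) h
      simp [atomIndex, ENNReal.inv_pow]
    · intro i hi
      by_contra h
      exact hi (Set.indicator_of_notMem (notMem_atomSet h) _)
  hasSum y j := by
    rw [← (atomIndex_injective y).hasSum_iff
      fun i hi => Set.indicator_of_notMem (notMem_atomSet hi) _]
    have h := hasSum_atoms y j
    convert! h using 2 with m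
    rw [Function.comp_apply, Set.indicator_of_mem (mem_atomSet_atomIndex.{u} y m)]
    simp [atomIndex]

end Existence

end GaussianAverage

end

/-! ### Assembly of the theorem -/

theorem theorem2p1 {𝕜 : Type*} [RCLike 𝕜] (X : Type u) [NormedAddCommGroup X] [NormedSpace 𝕜 X]
    [CompleteSpace X] (hX : GaussianAverage.HasGAP 𝕜 X) :
    ∃ K : ℝ≥0, ∀ E : Submodule 𝕜 X,
      (∀ T : GaussianAverage.Ell2 𝕜 →L[𝕜] E, GaussianAverage.IsFiniteRank T →
        GaussianAverage.piOne (GaussianAverage.adj T) ≤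
          K * GaussianAverage.piOne (GaussianAverage.adj T ∘L GaussianAverage.quotMap E)) ∧
      (∀ S : E →L[𝕜] GaussianAverage.Ell2 𝕜, GaussianAverage.FactorsThroughL1 S →
        ∃ S' : X →L[𝕜] GaussianAverage.Ell2 𝕜,
          (∀ x : E, S' (x : X) = S x) ∧
          GaussianAverage.FactorsThroughL1 S' ∧
          GaussianAverage.gammaOne S' ≤ K * GaussianAverage.gammaOne S) := by
  obtain ⟨C, hC⟩ := hX
  -- The factor 6 is the product of the bounds 2 for `coeffOp` and 3 for `sumOp`; the first claim
  -- holds without it.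
  refine ⟨6 * (GaussianAverage.khintchineConst * C), fun E => ⟨fun T hT => ?_, fun S hS => ?_⟩⟩
  · refine (GaussianAverage.piOne_adj_le_of_gap hC E T hT).trans ?_
    refine mul_le_mul_left (ENNReal.coe_le_coe.2 ?_) _
    exact le_mul_of_one_le_left' (by norm_num)
  · obtain ⟨A, hA, hAS⟩ := GaussianAverage.exists_dual_operator hC E S hS
    -- The space `L₁` of counting measure on this set is `ℓ₁`; `ULift` places the index set in the
    -- universe of `X`, as `FactorsThroughL1` requires.
    let _ : MeasurableSpace (ULift.{u} (ℕ × ℕ × ℕ)) := ⊤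
    have : DiscreteMeasurableSpace (ULift.{u} (ℕ × ℕ × ℕ)) := ⟨fun _ => trivial⟩
    let D := GaussianAverage.ballAtoms.{u} 𝕜
    refine ⟨D.sumOp ∘L (D.coeffOp ∘L A), fun x => ?_,
      ⟨_, _, Measure.count, D.coeffOp ∘L A, D.sumOp, rfl⟩, ?_⟩
    · ext j
      exact (D.sumOp_coeffOp (A x) j).trans (hAS x j)
    · have hle : GaussianAverage.gammaOne (D.sumOp ∘L (D.coeffOp ∘L A)) ≤
          ‖D.coeffOp ∘L A‖ₑ * ‖D.sumOp‖ₑ :=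
        sInf_le ⟨_, _, Measure.count, D.coeffOp ∘L A, D.sumOp, rfl, rfl⟩
      refine hle.trans ?_
      calc ‖D.coeffOp ∘L A‖ₑ * ‖D.sumOp‖ₑ
          ≤ (2 * ((GaussianAverage.khintchineConst * C : ℝ≥0) * GaussianAverage.gammaOne S)) * 3 := by
            refine mul_le_mul' ?_ D.enorm_sumOp_le
            refine le_trans ?_ (mul_le_mul' D.enorm_coeffOp_le hA)
            rw [← ofReal_norm, ← ofReal_norm, ← ofReal_norm, ← ENNReal.ofReal_mul (norm_nonneg _)]
            exact ENNReal.ofReal_le_ofReal (ContinuousLinearMap.opNorm_comp_le _ _)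
        _ = _ := by
            rw [ENNReal.coe_mul 6]
            push_cast
            ring
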